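/- Let $\Bbbk$ be a field, let $r,t\ge 3$ be integers, and let $P_r$ and $C_r$ denote the path and the cycle on $r$ vertices. For a finite simple graph $G$ with vertices $x_1,\dots,x_d$, let $\mathcal C_t(G)\subseteq S=\Bbbk[x_1,\dots,x_d]$ be the $t$-connected ideal, generated by all products $x_{i_1}\cdots x_{i_t}$ of $t$ distinct vertices that induce a connected subgraph of $G$. For a monomial ideal $I$ with minimal monomial generating set $\operatorname{mingens}(I)$, let $\operatorname{Scarf}(I)$ be the simplicial complex of all subsets $\sigma\subseteq\operatorname{mingens}(I)$ such that $\operatorname{lcm}(\sigma)\neq\operatorname{lcm}(\tau)$ for every subset $\tau\neq\sigma$ of $\operatorname{mingens}(I)$ (with $\operatorname{lcm}(\varnothing)=1$). For a simplicial complex $\Delta$ on $\operatorname{mingens}(I)$, let $\mathcal F_\Delta$ be the complex of free $S$-modules with one basis element $e_\sigma$ in homological degree $|\sigma|$ for each face $\sigma$ and with differential $e_\sigma\mapsto\sum_{v\in\sigma}\pm\frac{\operatorname{lcm}(\sigma)}{\operatorname{lcm}(\sigma\setminus v)}\,e_{\sigma\setminus v}$ (the usual simplicial signs). The ideal $I$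 is called Scarf if $\mathcal F_{\operatorname{Scarf}(I)}$, augmented by $S\to S/I$, is a free resolution of $S/I$. Then: 1. $\mathcal C_t(P_r)$ is Scarf if and only if $r\le 2t$. 2. $\mathcal C_t(C_r)$ is Scarf if and only if $r\le t$. Moreover: 3. If $r\le 2t$, then $\operatorname{Scarf}(\mathcal C_t(P_r))$ is a path on $\max(r-t+1,0)$ vertices (with only the empty face if $r<t$). 4. If $r=2t+1$, then $\operatorname{Scarf}(\mathcal C_t(P_r))$ is a hollow polygon with $t+2$ sides, and its first simplicial homology over $\Bbbk$ is nonzero. 5. If $r=t+1$, then $\operatorname{Scarf}(\mathcal C_t(C_r))$ consists of $t+1$ isolated vertices. 6. If $t+2\le r\le 2t+1$, then $\operatorname{Scarf}(\mathcal C_t(C_r))$ is a hollow polygon with $r$ sides, and its first simplicial homology over $\Bbbk$ is nonzero. -/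

import Mathlib

open scoped BigOperators

noncomputable section

namespace ScarfPC

/-- Exponent vectors: `m : Expo V` stands for the monomial `∏ v, x_v ^ m v`. Divisibility of
monomials is the pointwise order `≤`, and the least common multiple is the pointwise maximum. -/
abbrev Expo (V : Type*) : Type _ := V →₀ ℕ

/-- The `t`-connected ideal of a graph `G`: generated by the products of the vertices in the
`t`-element vertex sets whose induced subgraph is connected. -/
def connectedIdeal (k : Type*) [Field k] {V : Type*} (G : SimpleGraph V) (t : ℕ) :
    Ideal (MvPolynomial V k) :=
  Ideal.span {p | ∃ s : Finset V, s.card = t ∧ (G.induce (s : Set V)).Connected ∧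
    p = ∏ v ∈ s, MvPolynomial.X v}

/-- The minimal monomial generators of a monomial ideal: the monomials of `I` that are minimal
with respect to divisibility. -/
def mingens {k : Type*} [Field k] {V : Type*} (I : Ideal (MvPolynomial V k)) : Set (Expo V) :=
  {m | Minimal (fun e : Expo V => MvPolynomial.monomial e (1 : k) ∈ I) m}

/-- The label of a finite set of monomials; `lcm ∅ = 1`, i.e. the zero exponent. -/
def lcmLabel {V : Type*} (σ : Finset (Expo V)) : Expo V := σ.sup id

/-- Simplicial complexes with vertices in `α`: collections of finite sets (the faces, including
the empty face) closed under taking subsets. -/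
abbrev Complex (α : Type*) : Type _ := LowerSet (Finset α)

/-- The Scarf complex of a monomial ideal: the sets of minimal generators whose label is not the
label of any other set of minimal generators. -/
def scarf {k : Type*} [Field k] {V : Type*} (I : Ideal (MvPolynomial V k)) : Complex (Expo V) where
  carrier := {σ | (σ : Set (Expo V)) ⊆ mingens I ∧
    ∀ τ : Finset (Expo V), (τ : Set (Expo V)) ⊆ mingens I → lcmLabel σ = lcmLabel τ → σ = τ}
  lower' := by
    classical
    rintro σ τ hτσ ⟨hσ, hu⟩
    replace hτσ : τ ⊆ σ := hτσ
    refine ⟨fun x hx => hσ (hτσ hx), fun ρ hρ h => ?_⟩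
    have h1 : σ = ρ ∪ (σ \ τ) := by
      apply hu
      · intro x hx
        rcases Finset.mem_union.1 (Finset.mem_coe.1 hx) with hx | hx
        · exact hρ hx
        · exact hσ (Finset.mem_sdiff.1 hx).1
      · have : σ = τ ∪ (σ \ τ) := (Finset.union_sdiff_of_subset hτσ).symm
        unfold lcmLabel at h ⊢
        rw [Finset.sup_union, ← h, ← Finset.sup_union, ← this]
    have hρσ : ρ ⊆ σ := by rw [h1]; exact Finset.subset_union_left
    have h2 : σ = τ ∪ (σ \ ρ) := by
      apply hu
      · intro x hx
        rcases Finset.mem_union.1 (Finset.mem_coe.1 hx) with hx | hx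
        · exact hσ (hτσ hx)
        · exact hσ (Finset.mem_sdiff.1 hx).1
      · have : σ = ρ ∪ (σ \ ρ) := (Finset.union_sdiff_of_subset hρσ).symm
        unfold lcmLabel at h ⊢
        rw [Finset.sup_union, h, ← Finset.sup_union, ← this]
    ext x
    constructor
    · intro hx
      have hx' : x ∈ ρ ∪ (σ \ τ) := h1 ▸ hτσ hx
      simp only [Finset.mem_union, Finset.mem_sdiff] at hx'
      tauto
    · intro hx
      have hx' : x ∈ τ ∪ (σ \ ρ) := h2 ▸ hρσ hx
      simp only [Finset.mem_union, Finset.mem_sdiff] at hx'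
      tauto

/-- The faces of `Δ` with `n` elements (dimension `n - 1`). -/
abbrev Faces {α : Type*} (Δ : Complex α) (n : ℕ) : Type _ := {σ : Finset α // σ ∈ Δ ∧ σ.card = n}

/-- The face obtained by removing the vertex `v`. -/
def removeVertex {α : Type*} [DecidableEq α] {Δ : Complex α} {n : ℕ} (σ : Faces Δ (n + 1))
    (v : {x // x ∈ σ.1}) : Faces Δ n :=
  ⟨σ.1.erase v.1, Δ.lower (Finset.erase_subset v.1 σ.1) σ.2.1, by
    rw [Finset.card_erase_of_mem v.2, σ.2.2, Nat.add_sub_cancel]⟩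

section Boundary

variable {V : Type*} [LinearOrder V]

/-- The incidence sign: `(-1)^j`, where `j` is the number of vertices of `σ` that come before `v`
(the monomials are ordered lexicographically to orient the faces). -/
def sign (R : Type*) [CommRing R] (σ : Finset (Expo V)) (v : Expo V) : R :=
  (-1) ^ (σ.filter (fun u => toLex u < toLex v)).card

/-- The boundary map `e_σ ↦ ∑_{v ∈ σ} ± c(σ, v) e_{σ \ v}` with coefficients `c`, from the free
module on the faces with `n + 1` elements to the free module on those with `n` elements. -/
def boundary {R : Type*} [CommRing R] (Δ : Complex (Expo V)) (c : Finset (Expo V) → Expo V → R)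
    (n : ℕ) : (Faces Δ (n + 1) →₀ R) →ₗ[R] (Faces Δ n →₀ R) :=
  Finsupp.linearCombination R fun σ : Faces Δ (n + 1) =>
    ∑ v ∈ σ.1.attach, Finsupp.single (removeVertex σ v) (sign R σ.1 v.1 * c σ.1 v.1)

/-- The differential of the complex `F_Δ` of free `S`-modules (the homogenization of `Δ`), with
coefficients `lcm σ / lcm (σ \ v)`. The free module on the faces with `n` elements sits in
homological degree `n`. -/
def homogenizedBoundary (k : Type*) [Field k] (Δ : Complex (Expo V)) (n : ℕ) :
    (Faces Δ (n + 1) →₀ MvPolynomial V k) →ₗ[MvPolynomial V k]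
      (Faces Δ n →₀ MvPolynomial V k) :=
  boundary Δ (fun σ v => MvPolynomial.monomial (lcmLabel σ - lcmLabel (σ.erase v)) 1) n

/-- The augmentation from the degree `0` part of `F_Δ` to `S ⧸ I`, sending `e_∅` to `1`. -/
def augmentation {k : Type*} [Field k] (I : Ideal (MvPolynomial V k)) (Δ : Complex (Expo V)) :
    (Faces Δ 0 →₀ MvPolynomial V k) →ₗ[MvPolynomial V k] (MvPolynomial V k ⧸ I) :=
  Finsupp.linearCombination (MvPolynomial V k) fun _ => (1 : MvPolynomial V k ⧸ I)

/-- `Δ` supports a resolution of `S ⧸ I`: the augmented complex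
`⋯ → F_2 → F_1 → F_0 → S ⧸ I → 0` is exact. -/
structure SupportsResolution {k : Type*} [Field k] (I : Ideal (MvPolynomial V k))
    (Δ : Complex (Expo V)) : Prop where
  exact : ∀ n : ℕ, Function.Exact (homogenizedBoundary k Δ (n + 1)) (homogenizedBoundary k Δ n)
  exact_zero : Function.Exact (homogenizedBoundary k Δ 0) (augmentation I Δ)
  surjective : Function.Surjective (augmentation I Δ)

/-- A monomial ideal is Scarf if its Scarf complex supports a resolution of it. -/
def IsScarf {k : Type*} [Field k] (I : Ideal (MvPolynomial V k)) : Prop :=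
  SupportsResolution I (scarf I)

/-- The reduced simplicial boundary maps of `Δ` with coefficients in `k`. -/
def simplicialBoundary (k : Type*) [Field k] (Δ : Complex (Expo V)) (n : ℕ) :
    (Faces Δ (n + 1) →₀ k) →ₗ[k] (Faces Δ n →₀ k) :=
  boundary Δ (fun _ _ => 1) n

end Boundary

/-- The homology `ker g / im f` at the middle term of `A → B → C`. -/
abbrev middleHomology {R A B C : Type*} [CommRing R] [AddCommGroup A] [AddCommGroup B]
    [AddCommGroup C] [Module R A] [Module R B] [Module R C] (f : A →ₗ[R] B) (g : B →ₗ[R] C) :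
    Type _ :=
  LinearMap.ker g ⧸ (LinearMap.range f).submoduleOf (LinearMap.ker g)

/-- The reduced simplicial homology of `Δ` in degree `n` with coefficients in `k`: cycles modulo
boundaries at the `n`-dimensional faces, which have `n + 1` elements. -/
abbrev Homology (k : Type*) [Field k] {V : Type*} [LinearOrder V] (Δ : Complex (Expo V))
    (n : ℕ) : Type _ :=
  middleHomology (simplicialBoundary k Δ (n + 1)) (simplicialBoundary k Δ n)

/-- `Δ` is a copy of the graph `H`, seen as a simplicial complex of dimension at most one: up to
an injective renaming of vertices, its faces are the empty set, the vertices and the edges of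
`H`. -/
def IsCopyOfGraph {α W : Type*} (Δ : Complex α) (H : SimpleGraph W) : Prop :=
  ∃ f : W ↪ α, ∀ σ : Finset α, σ ∈ Δ ↔ (σ : Set α) = ∅ ∨ (∃ w, (σ : Set α) = {f w}) ∨
    ∃ w w', H.Adj w w' ∧ (σ : Set α) = {f w, f w'}

/-- `Δ` is a path on `n` vertices. -/
def IsPath {α : Type*} (Δ : Complex α) (n : ℕ) : Prop :=
  IsCopyOfGraph Δ (SimpleGraph.pathGraph n)

/-- `Δ` is a hollow `n`-gon, i.e. the boundary of a polygon with `n` sides. -/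
def IsHollowPolygon {α : Type*} (Δ : Complex α) (n : ℕ) : Prop :=
  3 ≤ n ∧ IsCopyOfGraph Δ (SimpleGraph.cycleGraph n)

/-- `Δ` consists of `n` isolated vertices. -/
def IsDiscrete {α : Type*} (Δ : Complex α) (n : ℕ) : Prop :=
  IsCopyOfGraph Δ (⊥ : SimpleGraph (Fin n))

end ScarfPC

end

/-!
All the ideals involved are generated by squarefree monomials whose supports form an antichain
`s i`; for paths and cycles with more than `t` vertices the supports are the arcs of `t`
consecutive vertices (`connected_pathGraph_iff`, `connected_cycleGraph_iff`). If `s l ⊆ s i ∪ s j`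
for a third index `l`, no Scarf face contains both `i` and `j`, since adding or deleting `l` does
not change the label. So the Scarf complex is a subcomplex of the clique complex of the graph of
the remaining pairs, and if that graph has no triangles, the complex is the graph itself
(`EncodesGraph.isCopyOfGraph`). For arcs this graph is a path for `P_r` with `r ≤ 2t`, a cycle for
`P_{2t+1}` and for `C_r` with `t + 2 ≤ r ≤ 2t + 1`, and has no edges for `C_{t+1}`.

In the path case the generators have linear quotients: the colon ideal of the earlier generators
by the next one is generated by a single variable, which is realized by the edge between the next
generator and its predecessor. This gives exactness at the vertices
(`mem_range_of_boundary_eq_zero`), and exactness at the edges holds because a path has a vertex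
that lies on only one edge (`eq_zero_of_boundary_eq_zero`).

A closed polygon of edges carries a cycle, both in simplicial chains and in the homogenized
complex (`exists_polygon_cycle`). A hollow polygon has no face bounding it, so its first homology
is nonzero. For the failure of exactness it suffices to find a polygon formed by all generators
dividing some monomial `U`: the cycle lives in degree `U`, where no Scarf face with three vertices
contributes (`not_isScarf_of_polygon`). If `r ≥ 2t + 1` for the path or `r ≥ 2t + 2` for the
cycle, the arcs inside the first `2t + 1` vertices form such a polygon; for shorter cycles all
arcs together do. On `C_{t+1}` the Scarf complex has no edges at all to resolve the syzygy between
two generators, and for `r ≤ t` the ideals of `C_r` and `P_r` coincide.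
-/

namespace ScarfPC

/-! ### Chains and boundary maps -/

section Chains

variable {α : Type*} {R : Type*} [CommRing R]

open Classical in
/-- The chain `a • e_σ`, read as `0` if `σ` is not a face of `Δ` with `n` elements. -/
noncomputable def faceChain (Δ : Complex α) (n : ℕ) (σ : Finset α) (a : R) : Faces Δ n →₀ R :=
  if h : σ ∈ Δ ∧ σ.card = n then Finsupp.single ⟨σ, h⟩ a else 0

theorem faceChain_of_mem {Δ : Complex α} {n : ℕ} {σ : Finset α} (h : σ ∈ Δ ∧ σ.card = n) (a : R) :
    faceChain Δ n σ a = Finsupp.single ⟨σ, h⟩ a := by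
  simp [faceChain, h]

theorem faceChain_apply [DecidableEq α] {Δ : Complex α} {n : ℕ} (σ : Finset α) (a : R)
    (ρ : Faces Δ n) : faceChain Δ n σ a ρ = if σ = ρ.1 then a else 0 := by
  classical
  by_cases h : σ ∈ Δ ∧ σ.card = n
  · rw [faceChain_of_mem h, Finsupp.single_apply]
    simp [Subtype.ext_iff]
  · have : σ ≠ ρ.1 := by
      rintro rfl
      exact h ρ.2
    simp [faceChain, h, this]

theorem faceChain_neg {Δ : Complex α} {n : ℕ} (σ : Finset α) (a : R) :
    faceChain Δ n σ (-a) = -faceChain Δ n σ a := by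
  classical
  ext ρ
  simp only [Finsupp.neg_apply, faceChain_apply]
  split_ifs <;> simp

end Chains

variable {V : Type*} [LinearOrder V] {R : Type*} [CommRing R]

theorem boundary_single (Δ : Complex (Expo V)) (c : Finset (Expo V) → Expo V → R) (n : ℕ)
    (σ : Faces Δ (n + 1)) (a : R) :
    boundary Δ c n (Finsupp.single σ a) =
      ∑ v ∈ σ.1, faceChain Δ n (σ.1.erase v) (a * (sign R σ.1 v * c σ.1 v)) := by
  rw [boundary, Finsupp.linearCombination_single, Finset.smul_sum, ← Finset.sum_attach σ.1]
  refine Finset.sum_congr rfl fun v _ => ?_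
  rw [Finsupp.smul_single, smul_eq_mul]
  exact (faceChain_of_mem (removeVertex σ v).2 _).symm

theorem boundary_apply (Δ : Complex (Expo V)) (c : Finset (Expo V) → Expo V → R) (n : ℕ)
    (z : Faces Δ (n + 1) →₀ R) (ρ : Faces Δ n) :
    boundary Δ c n z ρ = z.sum fun σ a =>
      ∑ v ∈ σ.1, if σ.1.erase v = ρ.1 then a * (sign R σ.1 v * c σ.1 v) else 0 := by
  conv_lhs => rw [← z.sum_single]
  rw [map_finsuppSum, Finsupp.sum, Finsupp.finsetSum_apply]
  refine Finset.sum_congr rfl fun σ _ => ?_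
  rw [boundary_single, Finsupp.finsetSum_apply]
  exact Finset.sum_congr rfl fun v _ => faceChain_apply _ _ _

theorem boundary_faceChain_singleton {Δ : Complex (Expo V)} (c : Finset (Expo V) → Expo V → R)
    {u : Expo V} (h : {u} ∈ Δ) (a : R) :
    boundary Δ c 0 (faceChain Δ 1 {u} a) = faceChain Δ 0 ∅ (a * c {u} u) := by
  have h' : ({u} : Finset (Expo V)) ∈ Δ ∧ Finset.card {u} = 1 := ⟨h, by simp⟩
  rw [faceChain_of_mem h', boundary_single, Finset.sum_singleton]
  simp [sign, Finset.filter_singleton]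

theorem sign_mul_self (σ : Finset (Expo V)) (v : Expo V) : sign R σ v * sign R σ v = 1 := by
  rw [sign, ← mul_pow]
  simp

theorem sign_pair_left {u v : Expo V} (huv : u ≠ v) :
    sign R {u, v} u = -sign R {u, v} v := by
  have h : toLex u ≠ toLex v := fun h => huv (toLex.injective h)
  rcases lt_or_gt_of_ne h with h | h
  · simp [sign, Finset.filter_insert, Finset.filter_singleton, h, h.not_gt]
  · have h' : toLex v < toLex u := h
    simp [sign, Finset.filter_insert, Finset.filter_singleton, h', h'.not_gt]

/-- With a suitable sign, the chain of the edge `{u, v}` is oriented from `v` to `u`. -/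
theorem exists_boundary_edge {Δ : Complex (Expo V)} {u v : Expo V} (huv : u ≠ v)
    (h : {u, v} ∈ Δ) (c : Finset (Expo V) → Expo V → R) :
    ∃ ε : R, ε * ε = 1 ∧ ∀ a, boundary Δ c 1 (faceChain Δ 2 {u, v} (ε * a)) =
      faceChain Δ 1 {u} (a * c {u, v} v) - faceChain Δ 1 {v} (a * c {u, v} u) := by
  refine ⟨sign R {u, v} v, sign_mul_self _ _, fun a => ?_⟩
  have h' : ({u, v} : Finset (Expo V)) ∈ Δ ∧ Finset.card {u, v} = 2 := ⟨h, Finset.card_pair huv⟩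
  have e1 : ({u, v} : Finset (Expo V)).erase u = {v} := by
    rw [Finset.erase_insert (by simpa using huv)]
  have e2 : ({u, v} : Finset (Expo V)).erase v = {u} := by
    rw [Finset.pair_comm, Finset.erase_insert (by simpa using huv.symm)]
  rw [faceChain_of_mem h', boundary_single, Finset.sum_pair huv, e1, e2, sign_pair_left huv,
    sub_eq_add_neg, ← faceChain_neg, add_comm]
  have hs := sign_mul_self (R := R) {u, v} v
  congr 2
  · linear_combination (a * c {u, v} v) * hs
  · linear_combination (-a * c {u, v} u) * hs

/-- A closed polygon of edges of `Δ` carries a cycle, whose coefficient at the first edge `ρ` is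
the weight of that edge up to a square root of `1`. The weights `a` on the edges are compatible
with the weights `b` on the vertices, so that the boundary telescopes. -/
theorem exists_polygon_cycle {Δ : Complex (Expo V)} {N : ℕ} (f : Fin (N + 3) → Expo V)
    (hf : Function.Injective f) (hΔ : ∀ i, {f i, f (i + 1)} ∈ Δ)
    (c : Finset (Expo V) → Expo V → R) (a : Fin (N + 3) → R) (b : Expo V → R)
    (h1 : ∀ i, a i * c {f i, f (i + 1)} (f (i + 1)) = b (f i))
    (h2 : ∀ i, a i * c {f i, f (i + 1)} (f i) = b (f (i + 1)))
    (ρ : Faces Δ 2) (hρ : ρ.1 = {f 0, f 1}) :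
    ∃ z : Faces Δ 2 →₀ R, boundary Δ c 1 z = 0 ∧ ∃ ε : R, ε * ε = 1 ∧ z ρ = ε * a 0 := by
  have hne : ∀ i, f i ≠ f (i + 1) := fun i h => by
    have := hf h
    simp at this
  choose ε hε hb using fun i => exists_boundary_edge (hne i) (hΔ i) c
  refine ⟨∑ i, faceChain Δ 2 {f i, f (i + 1)} (ε i * a i), ?_, ε 0, hε 0, ?_⟩
  · rw [map_sum]
    simp_rw [hb, h1, h2]
    rw [Finset.sum_sub_distrib, sub_eq_zero]
    exact (Equiv.sum_comp (Equiv.addRight (1 : Fin (N + 3)))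
      (fun i => faceChain Δ 1 {f i} (b (f i)))).symm
  · rw [Finsupp.finsetSum_apply, Finset.sum_eq_single 0]
    · rw [faceChain_apply, if_pos (by simp [hρ])]
    · intro i _ hi
      rw [faceChain_apply, if_neg]
      rw [hρ]
      intro h
      have m1 : f i ∈ ({f 0, f 1} : Finset (Expo V)) := h ▸ by simp
      have m2 : f (i + 1) ∈ ({f 0, f 1} : Finset (Expo V)) := h ▸ by simp
      simp only [Finset.mem_insert, Finset.mem_singleton, hf.eq_iff] at m1 m2
      rcases m1 with m1 | m1
      · exact hi m1
      · subst m1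
        rcases m2 with m2 | m2
        · simp [Fin.ext_iff, Fin.val_add, Nat.mod_eq_of_lt (show 2 < N + 3 by omega)] at m2
        · simp at m2
    · simp

/-- A complex that is a copy of a graph has no faces with more than two elements. -/
theorem IsCopyOfGraph.card_le {α W : Type*} {Δ : Complex α} {H : SimpleGraph W}
    (h : IsCopyOfGraph Δ H) {σ : Finset α} (hσ : σ ∈ Δ) : σ.card ≤ 2 := by
  classical
  obtain ⟨f, hf⟩ := h
  rcases (hf σ).1 hσ with h | ⟨w, h⟩ | ⟨w, w', -, h⟩
  · simp [Finset.coe_eq_empty.1 h]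
  · have : σ = {f w} := by exact_mod_cast h
    simp [this]
  · have : σ = {f w, f w'} := by exact_mod_cast h
    rw [this]
    exact Finset.card_le_two

theorem cycleGraph_adj_add_one {N : ℕ} (i : Fin (N + 3)) :
    (SimpleGraph.cycleGraph (N + 3)).Adj i (i + 1) := by
  rw [SimpleGraph.cycleGraph_adj]
  right
  simp

/-- The cycle around a hollow polygon is not a boundary, as there are no faces to bound it. -/
theorem IsHollowPolygon.nontrivial_homology (k : Type*) [Field k] {Δ : Complex (Expo V)} {n : ℕ}
    (h : IsHollowPolygon Δ n) : Nontrivial (Homology k Δ 1) := by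
  obtain ⟨hn, hΔ⟩ := h
  obtain ⟨N, rfl⟩ := Nat.exists_eq_add_of_le' hn
  have hcard := fun σ => hΔ.card_le (σ := σ)
  obtain ⟨f, hf⟩ := hΔ
  have hΔ : ∀ i, {f i, f (i + 1)} ∈ Δ := fun i =>
    (hf _).2 (Or.inr (Or.inr ⟨i, i + 1, cycleGraph_adj_add_one i, by simp⟩))
  have hc : Finset.card {f 0, f 1} = 2 := Finset.card_pair (f.injective.ne (by simp))
  obtain ⟨z, hz, ε, hε, hz'⟩ := exists_polygon_cycle (R := k) f f.injective hΔ (fun _ _ => 1)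
    (fun _ => 1) (fun _ => 1) (by simp) (by simp) ⟨{f 0, f 1}, by simpa using hΔ 0, hc⟩ rfl
  refine Submodule.Quotient.nontrivial_iff.2 ?_
  intro htop
  have hmem : (⟨z, hz⟩ : LinearMap.ker (simplicialBoundary k Δ 1)) ∈
      (LinearMap.range (simplicialBoundary k Δ 2)).submoduleOf _ := htop ▸ Submodule.mem_top
  obtain ⟨w, hw⟩ := hmem
  have : IsEmpty (Faces Δ (2 + 1)) := ⟨fun τ => by
    have := hcard _ τ.2.1
    have := τ.2.2
    omega⟩
  have hw0 : w = 0 := Subsingleton.elim _ _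
  have hz0 : z = 0 := by simpa [hw0] using hw.symm
  rw [hz0] at hz'
  have : ε = 0 := by simpa using hz'.symm
  simp [this] at hε

/-! ### Squarefree monomials and their Scarf complexes -/

section Squarefree

variable {V : Type*} {ι : Type*}

/-- The exponent vector of the squarefree monomial `∏ v ∈ S, x_v`. -/
noncomputable def sqfree (S : Finset V) : Expo V := ∑ v ∈ S, Finsupp.single v 1

theorem sqfree_apply [DecidableEq V] (S : Finset V) (v : V) :
    sqfree S v = if v ∈ S then 1 else 0 := by
  simp [sqfree, Finsupp.finsetSum_apply, Finsupp.single_apply]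

theorem sqfree_le_sqfree {S T : Finset V} : sqfree S ≤ sqfree T ↔ S ⊆ T := by
  classical
  rw [Finsupp.le_iff]
  constructor
  · intro h v hv
    by_contra hv'
    have := h v (by simp [sqfree_apply, hv])
    simp [sqfree_apply, hv, hv'] at this
  · intro h v _
    rw [sqfree_apply, sqfree_apply]
    split_ifs with h1 h2
    · exact le_rfl
    · exact absurd (h h1) h2
    all_goals simp

theorem sqfree_injective : Function.Injective (sqfree : Finset V → Expo V) := fun _ _ h =>
  (sqfree_le_sqfree.1 h.le).antisymm (sqfree_le_sqfree.1 h.ge)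

theorem sqfree_union [DecidableEq V] (S T : Finset V) :
    sqfree (S ∪ T) = sqfree S ⊔ sqfree T := by
  ext v
  simp only [sqfree_apply, Finsupp.sup_apply, Finset.mem_union]
  by_cases h1 : v ∈ S <;> by_cases h2 : v ∈ T <;> simp [h1, h2]

theorem lcmLabel_image_sqfree [DecidableEq V] (s : ι → Finset V) (T : Finset ι) :
    lcmLabel (T.image fun i => sqfree (s i)) = sqfree (T.biUnion s) := by
  classical
  induction T using Finset.induction_on with
  | empty => exact (bot_eq_zero : (⊥ : Expo V) = 0)
  | insert i T hi ih =>
    rw [Finset.image_insert, Finset.biUnion_insert, sqfree_union, ← ih]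
    simp [lcmLabel]

variable (k : Type*) [Field k]

/-- The ideal generated by the squarefree monomials with supports `s i`. -/
noncomputable def sqfreeIdeal (s : ι → Finset V) : Ideal (MvPolynomial V k) :=
  Ideal.span (Set.range fun i => MvPolynomial.monomial (sqfree (s i)) 1)

variable {k}

theorem prod_X_eq_monomial (S : Finset V) :
    ∏ v ∈ S, (MvPolynomial.X v : MvPolynomial V k) = MvPolynomial.monomial (sqfree S) 1 := by
  rw [sqfree, MvPolynomial.monomial_sum_one]
  rfl

theorem monomial_mem_sqfreeIdeal {s : ι → Finset V} {e : Expo V} :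
    MvPolynomial.monomial e (1 : k) ∈ sqfreeIdeal k s ↔ ∃ i, sqfree (s i) ≤ e := by
  classical
  have h : sqfreeIdeal k s = Ideal.span ((fun m => MvPolynomial.monomial m (1 : k)) ''
      Set.range fun i => sqfree (s i)) := by
    rw [← Set.range_comp]
    rfl
  rw [h, MvPolynomial.mem_ideal_span_monomial_image]
  simp [MvPolynomial.support_monomial]

variable {s : ι → Finset V}

theorem mingens_sqfreeIdeal (hs : ∀ i j, s i ⊆ s j → i = j) :
    mingens (sqfreeIdeal k s) = Set.range fun i => sqfree (s i) := by
  ext m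
  simp only [mingens, Set.mem_ofPred_eq, monomial_mem_sqfreeIdeal, Set.mem_range]
  constructor
  · rintro ⟨⟨i, hi⟩, hm⟩
    exact ⟨i, le_antisymm hi (hm ⟨i, le_rfl⟩ hi)⟩
  · rintro ⟨i, rfl⟩
    refine ⟨⟨i, le_rfl⟩, ?_⟩
    rintro e ⟨j, hj⟩ he
    obtain rfl := hs j i (sqfree_le_sqfree.1 (hj.trans he))
    exact hj

variable [DecidableEq V]

theorem exists_image_of_mem_scarf (hs : ∀ i j, s i ⊆ s j → i = j) {σ : Finset (Expo V)}
    (hσ : σ ∈ scarf (sqfreeIdeal k s)) :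
    ∃ T : Finset ι, T.image (fun i => sqfree (s i)) = σ := by
  classical
  have h := hσ.1
  rw [mingens_sqfreeIdeal hs, ← Set.image_univ] at h
  obtain ⟨T, -, hT⟩ := Finset.subset_set_image_iff.1 h
  exact ⟨T, hT⟩

/-- A face of the Scarf complex is determined by the union of the supports of its vertices. -/
theorem image_mem_scarf (hs : ∀ i j, s i ⊆ s j → i = j) {T : Finset ι} :
    T.image (fun i => sqfree (s i)) ∈ scarf (sqfreeIdeal k s) ↔
      ∀ T' : Finset ι, T.biUnion s = T'.biUnion s → T = T' := by
  classical
  have hinj : Function.Injective fun i => sqfree (s i) := fun i j h =>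
    hs i j (sqfree_injective h).subset
  have hsub : ∀ T : Finset ι, ((T.image fun i => sqfree (s i) : Finset (Expo V)) : Set (Expo V)) ⊆
      mingens (sqfreeIdeal k s) := fun T => by
    rw [mingens_sqfreeIdeal hs, Finset.coe_image]
    exact Set.image_subset_range _ _
  constructor
  · intro h T' hT'
    refine Finset.image_injective hinj (h.2 _ (hsub T') ?_)
    rw [lcmLabel_image_sqfree, lcmLabel_image_sqfree, hT']
  · refine fun h => ⟨hsub T, fun τ hτ hl => ?_⟩
    rw [mingens_sqfreeIdeal hs, ← Set.image_univ] at hτ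
    obtain ⟨T', -, rfl⟩ := Finset.subset_set_image_iff.1 hτ
    rw [lcmLabel_image_sqfree, lcmLabel_image_sqfree] at hl
    rw [h T' (sqfree_injective hl)]

/-- If `s l` is covered by two vertices of a Scarf face, it is one of them: otherwise adding and
deleting `l` gives two sets of generators with the same label. -/
theorem eq_or_eq_of_mem_scarf (hs : ∀ i j, s i ⊆ s j → i = j) {T : Finset ι}
    (hT : T.image (fun i => sqfree (s i)) ∈ scarf (sqfreeIdeal k s)) {i j l : ι} (hi : i ∈ T)
    (hj : j ∈ T) (hl : s l ⊆ s i ∪ s j) : l = i ∨ l = j := by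
  classical
  rw [image_mem_scarf hs] at hT
  by_contra! h
  have hi' : i ∈ T.erase l := Finset.mem_erase.2 ⟨h.1.symm, hi⟩
  have hj' : j ∈ T.erase l := Finset.mem_erase.2 ⟨h.2.symm, hj⟩
  have key : s l ⊆ (T.erase l).biUnion s := hl.trans (Finset.union_subset
    (Finset.subset_biUnion_of_mem s hi') (Finset.subset_biUnion_of_mem s hj'))
  by_cases hlT : l ∈ T
  · have : T = T.erase l := hT _ (by
      conv_lhs => rw [← Finset.insert_erase hlT, Finset.biUnion_insert]
      exact Finset.union_eq_right.2 key)
    rw [this] at hlT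
    simp at hlT
  · rw [Finset.erase_eq_of_notMem hlT] at key
    have : T = insert l T := hT _ (by
      rw [Finset.biUnion_insert]
      exact (Finset.union_eq_right.2 key).symm)
    exact hlT (this ▸ Finset.mem_insert_self l T)

/-- A set of generators is a Scarf face if no further generator divides its label and each of its
members is needed for the label. -/
theorem image_mem_scarf_of (hs : ∀ i j, s i ⊆ s j → i = j) [DecidableEq ι] {T : Finset ι}
    (h1 : ∀ l, s l ⊆ T.biUnion s → l ∈ T) (h2 : ∀ i ∈ T, ¬ s i ⊆ (T.erase i).biUnion s) :
    T.image (fun i => sqfree (s i)) ∈ scarf (sqfreeIdeal k s) := by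
  rw [image_mem_scarf hs]
  intro T' h
  have hT' : T' ⊆ T := fun l hl => h1 l (h ▸ Finset.subset_biUnion_of_mem s hl)
  refine Finset.Subset.antisymm (fun i hi => ?_) hT'
  by_contra hi'
  refine h2 i hi (((Finset.subset_biUnion_of_mem s hi).trans h.subset).trans
    (Finset.biUnion_subset_biUnion_of_subset_left s fun j hj => Finset.mem_erase.2 ⟨?_, hT' hj⟩))
  rintro rfl
  exact hi' hj

theorem singleton_mem_scarf (hs : ∀ i j, s i ⊆ s j → i = j) {i : ι} (h : (s i).Nonempty) :
    {sqfree (s i)} ∈ scarf (sqfreeIdeal k s) := by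
  classical
  simpa using image_mem_scarf_of (k := k) hs (T := {i})
    (fun l hl => by simpa using hs l i (by simpa using hl)) (by simpa using h.ne_empty)

theorem pair_mem_scarf (hs : ∀ i j, s i ⊆ s j → i = j) {i j : ι} (hne : i ≠ j)
    (h : ∀ l, s l ⊆ s i ∪ s j → l = i ∨ l = j) :
    {sqfree (s i), sqfree (s j)} ∈ scarf (sqfreeIdeal k s) := by
  classical
  have := image_mem_scarf_of (k := k) hs (T := {i, j})
    (fun l hl => by simpa using h l (by simpa [Finset.biUnion_insert] using hl))
    (by
      intro l hl hl'
      rcases (by simpa using hl : l = i ∨ l = j) with rfl | rfl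
      · rw [Finset.erase_insert (by simpa using hne)] at hl'
        exact hne (hs _ _ (by simpa using hl'))
      · rw [Finset.pair_comm, Finset.erase_insert (by simpa using hne.symm)] at hl'
        exact hne (hs _ _ (by simpa using hl')).symm)
  simpa [Finset.image_insert] using this

/-- The family `s` is an antichain of nonempty sets, and the union of two of its members contains
a third one exactly when their indices are not adjacent in `H`. Then the edges of the Scarf complex
of the ideal generated by `s` are the edges of `H`. -/
structure EncodesGraph (s : ι → Finset V) (H : SimpleGraph ι) : Prop where
  nonempty : ∀ i, (s i).Nonempty
  antichain : ∀ i j, s i ⊆ s j → i = j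
  of_adj : ∀ i j l, H.Adj i j → s l ⊆ s i ∪ s j → l = i ∨ l = j
  of_not_adj : ∀ i j, i ≠ j → ¬ H.Adj i j → ∃ l, s l ⊆ s i ∪ s j ∧ l ≠ i ∧ l ≠ j

theorem EncodesGraph.isCopyOfGraph {H : SimpleGraph ι} (h : EncodesGraph s H)
    (hH : ∀ i j l, H.Adj i j → H.Adj j l → ¬ H.Adj i l) :
    IsCopyOfGraph (scarf (sqfreeIdeal k s)) H := by
  classical
  have hs := h.antichain
  have hinj : Function.Injective fun i => sqfree (s i) := fun i j h =>
    hs i j (sqfree_injective h).subset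
  refine ⟨⟨fun i => sqfree (s i), hinj⟩, fun σ => ⟨fun hσ => ?_, ?_⟩⟩
  · obtain ⟨T, rfl⟩ := exists_image_of_mem_scarf hs hσ
    have hadj : ∀ i ∈ T, ∀ j ∈ T, i ≠ j → H.Adj i j := fun i hi j hj hij => by
      by_contra hn
      obtain ⟨l, hl, h1, h2⟩ := h.of_not_adj i j hij hn
      have := eq_or_eq_of_mem_scarf hs hσ hi hj hl
      tauto
    have hcard : T.card < 3 := by
      by_contra hc
      obtain ⟨a, b, c, ha, hb, hc, hab, hac, hbc⟩ :=
        Finset.two_lt_card_iff.1 (show 2 < T.card by omega)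
      exact hH a b c (hadj a ha b hb hab) (hadj b hb c hc hbc) (hadj a ha c hc hac)
    interval_cases hT : T.card
    · left
      simp [Finset.card_eq_zero.1 hT]
    · obtain ⟨i, rfl⟩ := Finset.card_eq_one.1 hT
      exact Or.inr (Or.inl ⟨i, by simp⟩)
    · obtain ⟨i, j, hij, rfl⟩ := Finset.card_eq_two.1 hT
      exact Or.inr (Or.inr ⟨i, j, hadj i (by simp) j (by simp) hij, by simp⟩)
  · rintro (h0 | ⟨i, hi⟩ | ⟨i, j, hij, hσ⟩)
    · have := image_mem_scarf_of (k := k) hs (T := ∅)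
        (fun l hl => absurd (Finset.subset_empty.1 hl) (h.nonempty l).ne_empty) (by simp)
      rw [Finset.coe_eq_empty] at h0
      simpa [h0] using this
    · have hi : σ = {sqfree (s i)} := by exact_mod_cast hi
      exact hi ▸ singleton_mem_scarf hs (h.nonempty i)
    · have hσ : σ = {sqfree (s i), sqfree (s j)} := by exact_mod_cast hσ
      exact hσ ▸ pair_mem_scarf hs hij.ne fun l => h.of_adj i j l hij

end Squarefree

/-! ### The homogenized complex in low degrees -/

section Homogenized

open MvPolynomial

theorem lcmLabel_singleton {V : Type*} (u : Expo V) : lcmLabel {u} = u := Finset.sup_singleton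

theorem augmentation_single {V : Type*} {k : Type*} [Field k] (I : Ideal (MvPolynomial V k))
    {Δ : Complex (Expo V)} (e : Faces Δ 0) (p : MvPolynomial V k) :
    augmentation I Δ (Finsupp.single e p) = Ideal.Quotient.mk I p := by
  rw [augmentation, Finsupp.linearCombination_single]
  change Ideal.Quotient.mk I (p * 1) = _
  rw [mul_one]

theorem augmentation_surjective {V : Type*} {k : Type*} [Field k]
    (I : Ideal (MvPolynomial V k)) {Δ : Complex (Expo V)} (h : ∅ ∈ Δ) :
    Function.Surjective (augmentation I Δ) := by
  intro q
  obtain ⟨p, rfl⟩ := Ideal.Quotient.mk_surjective q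
  exact ⟨Finsupp.single ⟨∅, h, rfl⟩ p, augmentation_single I _ p⟩

variable {V : Type*} [LinearOrder V] {k : Type*} [Field k]

theorem lcmLabel_pair (u v : Expo V) : lcmLabel {u, v} = u ⊔ v := by
  simp [lcmLabel]

theorem monomial_lcmLabel_singleton (u : Expo V) :
    monomial (lcmLabel {u} - lcmLabel (({u} : Finset (Expo V)).erase u)) (1 : k) =
      monomial u 1 := by
  rw [Finset.erase_singleton, lcmLabel_singleton]
  simp [lcmLabel, bot_eq_zero]

theorem homogenizedBoundary_faceChain_singleton {Δ : Complex (Expo V)} {u : Expo V} (h : {u} ∈ Δ)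
    (a : MvPolynomial V k) :
    homogenizedBoundary k Δ 0 (faceChain Δ 1 {u} a) = faceChain Δ 0 ∅ (a * monomial u 1) := by
  rw [homogenizedBoundary, boundary_faceChain_singleton _ h, monomial_lcmLabel_singleton]

theorem exists_homogenizedBoundary_edge {Δ : Complex (Expo V)} {u v : Expo V} (huv : u ≠ v)
    (h : {u, v} ∈ Δ) :
    ∃ ε : MvPolynomial V k, ε * ε = 1 ∧ ∀ a,
      homogenizedBoundary k Δ 1 (faceChain Δ 2 {u, v} (ε * a)) =
        faceChain Δ 1 {u} (a * monomial (u ⊔ v - u) 1) -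
          faceChain Δ 1 {v} (a * monomial (u ⊔ v - v) 1) := by
  obtain ⟨ε, hε, hb⟩ := exists_boundary_edge huv h
    (fun σ v => (monomial (lcmLabel σ - lcmLabel (σ.erase v)) 1 : MvPolynomial V k))
  refine ⟨ε, hε, fun a => ?_⟩
  have e1 : ({u, v} : Finset (Expo V)).erase u = {v} := by
    rw [Finset.erase_insert (by simpa using huv)]
  have e2 : ({u, v} : Finset (Expo V)).erase v = {u} := by
    rw [Finset.pair_comm, Finset.erase_insert (by simpa using huv.symm)]
  rw [homogenizedBoundary, hb, e1, e2, lcmLabel_pair, lcmLabel_singleton, lcmLabel_singleton]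

theorem homogenizedBoundary_comp (Δ : Complex (Expo V)) (z : Faces Δ 2 →₀ MvPolynomial V k) :
    homogenizedBoundary k Δ 0 (homogenizedBoundary k Δ 1 z) = 0 := by
  induction z using Finsupp.induction_linear with
  | zero => simp
  | add f g hf hg => rw [map_add, map_add, hf, hg, add_zero]
  | single σ a =>
    obtain ⟨u, v, huv, hσ⟩ := Finset.card_eq_two.1 σ.2.2
    have hΔ : {u, v} ∈ Δ := hσ ▸ σ.2.1
    obtain ⟨ε, hε, hb⟩ := exists_homogenizedBoundary_edge (k := k) huv hΔ
    have hu : {u} ∈ Δ := Δ.lower (by simp) hΔ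
    have hv : {v} ∈ Δ := Δ.lower (by simp) hΔ
    have ha : Finsupp.single σ a = faceChain Δ 2 {u, v} (ε * (ε * a)) := by
      rw [← mul_assoc, hε, one_mul, faceChain_of_mem ⟨hΔ, Finset.card_pair huv⟩]
      congr 1
      exact Subtype.ext hσ
    rw [ha, hb, map_sub, homogenizedBoundary_faceChain_singleton hu,
      homogenizedBoundary_faceChain_singleton hv, mul_assoc, mul_assoc (ε * a), monomial_mul,
      monomial_mul, tsub_add_cancel_of_le le_sup_left, tsub_add_cancel_of_le le_sup_right, sub_self]

theorem homogenizedBoundary_zero_apply {ι : Type*} [Fintype ι] {Δ : Complex (Expo V)}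
    (m : ι → Expo V) (hm : Function.Injective m) (e : ι → Faces Δ 1) (he : ∀ i, (e i).1 = {m i})
    (hsurj : Function.Surjective e) (y : Faces Δ 1 →₀ MvPolynomial V k) :
    homogenizedBoundary k Δ 0 y = faceChain Δ 0 ∅ (∑ i, y (e i) * monomial (m i) 1) := by
  have hy : y = ∑ i, faceChain Δ 1 {m i} (y (e i)) := by
    ext1 ρ
    obtain ⟨j, rfl⟩ := hsurj ρ
    rw [Finsupp.finsetSum_apply, Finset.sum_eq_single j]
    · rw [faceChain_apply, he, if_pos rfl]
    · intro i _ hij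
      rw [faceChain_apply, he, if_neg]
      simpa using hm.ne hij
    · simp
  have hΔ : ∀ i, {m i} ∈ Δ := fun i => he i ▸ (e i).2.1
  conv_lhs => rw [hy]
  rw [map_sum]
  simp_rw [homogenizedBoundary_faceChain_singleton (hΔ _)]
  ext1 ρ
  have hρ : ρ.1 = ∅ := Finset.card_eq_zero.1 ρ.2.2
  simp [faceChain_apply, hρ]

/-- The Scarf complex of a squarefree monomial ideal always gives the first step of a
resolution. -/
theorem exact_augmentation_scarf {ι : Type*} {s : ι → Finset V} (hs : ∀ i j, s i ⊆ s j → i = j)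
    (hne : ∀ i, (s i).Nonempty) (h0 : ∅ ∈ scarf (sqfreeIdeal k s)) :
    Function.Exact (homogenizedBoundary k (scarf (sqfreeIdeal k s)) 0)
      (augmentation (sqfreeIdeal k s) (scarf (sqfreeIdeal k s))) := by
  set I := sqfreeIdeal k s with hI
  set Δ := scarf I
  let e₀ : Faces Δ 0 := ⟨∅, h0, rfl⟩
  have hsingle : ∀ y : Faces Δ 0 →₀ MvPolynomial V k, y = Finsupp.single e₀ (y e₀) := fun y => by
    ext1 ρ
    obtain rfl : ρ = e₀ := Subtype.ext (Finset.card_eq_zero.1 ρ.2.2)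
    simp
  intro y
  constructor
  · intro hy
    rw [hsingle y, augmentation_single, Ideal.Quotient.eq_zero_iff_mem] at hy
    have hle : I ≤ (LinearMap.range (homogenizedBoundary k Δ 0)).comap
        (Finsupp.lsingle (R := MvPolynomial V k) e₀) := by
      rw [hI, sqfreeIdeal, Ideal.span_le]
      rintro _ ⟨i, rfl⟩
      refine ⟨faceChain Δ 1 {sqfree (s i)} 1, ?_⟩
      rw [homogenizedBoundary_faceChain_singleton (singleton_mem_scarf hs (hne i)), one_mul,
        faceChain_of_mem ⟨h0, Finset.card_empty⟩]
      rfl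
    rw [hsingle y]
    exact hle hy
  · rintro ⟨z, rfl⟩
    induction z using Finsupp.induction_linear with
    | zero => simp
    | add f g hf hg => rw [map_add, map_add, hf, hg, add_zero]
    | single σ a =>
      obtain ⟨u, hσ⟩ := Finset.card_eq_one.1 σ.2.2
      have hΔ : {u} ∈ Δ := hσ ▸ σ.2.1
      have hu : u ∈ mingens I := hΔ.1 (by simp)
      have ha : Finsupp.single σ a = faceChain Δ 1 {u} a := by
        rw [faceChain_of_mem ⟨hΔ, Finset.card_singleton u⟩]
        congr 1
        exact Subtype.ext hσ
      rw [ha, homogenizedBoundary_faceChain_singleton hΔ,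
        faceChain_of_mem ⟨h0, Finset.card_empty⟩, augmentation_single,
        Ideal.Quotient.eq_zero_iff_mem]
      exact I.mul_mem_left a (Minimal.prop (P := fun e => monomial e (1 : k) ∈ I) hu)

end Homogenized

/-! ### Obstructions to being Scarf -/

section Obstructions

open MvPolynomial

variable {V : Type*} [LinearOrder V] {k : Type*} [Field k]

/-- Without edges in the Scarf complex, the syzygy between two generators is not resolved. -/
theorem not_isScarf_of_card_le_one {ι : Type*} {s : ι → Finset V}
    (hs : ∀ i j, s i ⊆ s j → i = j) (hne : ∀ i, (s i).Nonempty) {i j : ι} (hij : i ≠ j)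
    (h : ∀ σ ∈ scarf (sqfreeIdeal k s), σ.card ≤ 1) : ¬ IsScarf (sqfreeIdeal k s) := by
  intro hI
  set Δ := scarf (sqfreeIdeal k s)
  have hi : {sqfree (s i)} ∈ Δ := singleton_mem_scarf hs (hne i)
  have hj : {sqfree (s j)} ∈ Δ := singleton_mem_scarf hs (hne j)
  have hm : sqfree (s i) ≠ sqfree (s j) := fun h => hij (hs i j (sqfree_injective h).subset)
  generalize sqfree (s i) = u at *
  generalize sqfree (s j) = v at *
  have hker : homogenizedBoundary k Δ 0 (faceChain Δ 1 {u} (monomial (u ⊔ v - u) 1) -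
      faceChain Δ 1 {v} (monomial (u ⊔ v - v) 1)) = 0 := by
    rw [map_sub, homogenizedBoundary_faceChain_singleton hi,
      homogenizedBoundary_faceChain_singleton hj, monomial_mul, monomial_mul,
      tsub_add_cancel_of_le le_sup_left, tsub_add_cancel_of_le le_sup_right, sub_self]
  obtain ⟨w, hw⟩ := (hI.exact 0 _).1 hker
  have : IsEmpty (Faces Δ (0 + 1 + 1)) := ⟨fun τ => by
    have := h _ τ.2.1
    have := τ.2.2
    omega⟩
  obtain rfl : w = 0 := Subsingleton.elim _ _
  have := DFunLike.congr_fun hw ⟨{u}, hi, rfl⟩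
  simp [faceChain_apply, hm.symm, eq_comm (a := (0 : MvPolynomial V k))] at this

/-- If the generators dividing some monomial `U` form a Scarf polygon with at least four sides,
the ideal is not Scarf. In degree `U` the polygon gives a syzygy of the edges, while no Scarf face
with three vertices contains one of its edges and has a label dividing `U`. -/
theorem not_isScarf_of_polygon {ι : Type*} {s : ι → Finset V} (hs : ∀ i j, s i ⊆ s j → i = j)
    {N : ℕ} (f : Fin (N + 3) ↪ ι) (hf : EncodesGraph (s ∘ f) (SimpleGraph.cycleGraph (N + 3)))
    (htri : ∀ i j l, (SimpleGraph.cycleGraph (N + 3)).Adj i j →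
      (SimpleGraph.cycleGraph (N + 3)).Adj j l → ¬ (SimpleGraph.cycleGraph (N + 3)).Adj i l)
    (U : Finset V) (hU : ∀ l, s l ⊆ U ↔ l ∈ Set.range f) : ¬ IsScarf (sqfreeIdeal k s) := by
  classical
  intro hI
  set Δ := scarf (sqfreeIdeal k s) 
  let m : Fin (N + 3) → Expo V := fun i => sqfree (s (f i))
  have hm : Function.Injective m := fun i j h =>
    f.injective (hs _ _ (sqfree_injective h).subset)
  have hsU : ∀ i, s (f i) ⊆ U := fun i => (hU _).2 ⟨i, rfl⟩
  have hmU : ∀ i, m i ≤ sqfree U := fun i => sqfree_le_sqfree.2 (hsU i)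
  have hΔ : ∀ i, {m i, m (i + 1)} ∈ Δ := fun i => by
    have hadj := cycleGraph_adj_add_one i
    refine pair_mem_scarf hs (f.injective.ne hadj.ne) fun l hl => ?_
    obtain ⟨l, rfl⟩ := (hU l).1 (hl.trans (Finset.union_subset (hsU _) (hsU _)))
    simpa using hf.of_adj i (i + 1) l hadj hl
  have hne : ∀ i, m i ≠ m (i + 1) := fun i => hm.ne (cycleGraph_adj_add_one i).ne
  have e1 : ∀ i, ({m i, m (i + 1)} : Finset (Expo V)).erase (m i) = {m (i + 1)} := fun i => by
    rw [Finset.erase_insert (by simpa using hne i)]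
  have e2 : ∀ i, ({m i, m (i + 1)} : Finset (Expo V)).erase (m (i + 1)) = {m i} := fun i => by
    rw [Finset.pair_comm, Finset.erase_insert (by simpa using (hne i).symm)]
  have hmul : ∀ (u v : Expo V), u ≤ v → v ≤ sqfree U →
      (monomial (sqfree U - v) 1 * monomial (v - u) 1 : MvPolynomial V k) =
        monomial (sqfree U - u) 1 := fun u v h1 h2 => by
    rw [monomial_mul, tsub_add_tsub_cancel h2 h1, one_mul]
  let ρ : Faces Δ 2 := ⟨{m 0, m 1}, by simpa using hΔ 0, Finset.card_pair (hm.ne (by simp))⟩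
  obtain ⟨z, hz, ε, hε, hzρ⟩ := exists_polygon_cycle m hm hΔ
    (fun σ v => (monomial (lcmLabel σ - lcmLabel (σ.erase v)) 1 : MvPolynomial V k))
    (fun i => monomial (sqfree U - m i ⊔ m (i + 1)) 1) (fun v => monomial (sqfree U - v) 1)
    (fun i => by
      rw [e2, lcmLabel_singleton, lcmLabel_pair]
      exact hmul _ _ le_sup_left (sup_le (hmU _) (hmU _)))
    (fun i => by
      rw [e1, lcmLabel_singleton, lcmLabel_pair]
      exact hmul _ _ le_sup_right (sup_le (hmU _) (hmU _)))
    ρ rfl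
  obtain ⟨w, hw⟩ := (hI.exact 1 _).1 hz
  -- The coefficient of the edge `ρ` in the boundary of `w` has no term in degree `U`.
  have hcoeff : coeff (sqfree U - lcmLabel ρ.1) (homogenizedBoundary k Δ 2 w ρ) = 0 := by
    rw [homogenizedBoundary, boundary_apply, Finsupp.sum, coeff_sum]
    refine Finset.sum_eq_zero fun τ _ => ?_
    rw [coeff_sum]
    refine Finset.sum_eq_zero fun v hv => ?_
    split_ifs with hτ
    swap
    · simp
    -- A contributing face `τ` would have label dividing `U`, so it would consist of three
    -- vertices of the polygon that are pairwise adjacent.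
    rw [← mul_assoc, coeff_mul_monomial', if_neg]
    rw [hτ]
    intro hle
    have hρτ : ρ.1 ⊆ τ.1 := hτ ▸ Finset.erase_subset _ _
    have hlρ : lcmLabel ρ.1 ≤ lcmLabel τ.1 := Finset.sup_mono hρτ
    have hρU : lcmLabel ρ.1 ≤ sqfree U := by
      rw [lcmLabel_pair]
      exact sup_le (hmU _) (hmU _)
    have hτU : lcmLabel τ.1 ≤ sqfree U :=
      (tsub_le_iff_right.1 hle).trans (tsub_add_cancel_of_le hρU).le
    obtain ⟨T, hT⟩ := exists_image_of_mem_scarf hs τ.2.1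
    have hvU : v ≤ sqfree U := (Finset.le_sup (f := id) hv).trans hτU
    have hmem : ∀ i, m i ∈ τ.1 → f i ∈ T := fun i hi => by
      rw [← hT, Finset.mem_image] at hi
      obtain ⟨l, hl, hli⟩ := hi
      have := hs _ _ (sqfree_injective hli).subset
      exact this ▸ hl
    obtain ⟨l, hlT, rfl⟩ := Finset.mem_image.1 (hT ▸ hv)
    obtain ⟨j, rfl⟩ := (hU l).1 (sqfree_le_sqfree.1 hvU)
    have hvρ : m j ∉ ρ.1 := hτ ▸ Finset.notMem_erase _ _
    have hadj : ∀ i, m i ∈ ρ.1 → (SimpleGraph.cycleGraph (N + 3)).Adj i j := fun i hi => by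
      by_contra hn
      have hij : i ≠ j := by
        rintro rfl
        exact hvρ hi
      obtain ⟨l, hl, h1, h2⟩ := hf.of_not_adj i j hij hn
      have := eq_or_eq_of_mem_scarf hs (hT ▸ τ.2.1) (hmem i (hρτ hi)) (hmem j hv) hl
      simp only [f.injective.eq_iff] at this
      tauto
    exact htri 0 1 j (by simpa using cycleGraph_adj_add_one (0 : Fin (N + 3)))
      (hadj 1 (by simp [ρ])) (hadj 0 (by simp [ρ]))
  rw [hw, hzρ] at hcoeff
  have hlabel : lcmLabel ρ.1 = m 0 ⊔ m (0 + 1) := by simp [ρ, lcmLabel_pair]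
  rw [hlabel] at hcoeff
  rcases mul_self_eq_one_iff.1 hε with rfl | rfl <;> simp at hcoeff

end Obstructions

/-! ### Resolutions supported on paths -/

section PathResolution

open MvPolynomial

variable {V : Type*} [LinearOrder V] {k : Type*} [Field k]

/-- The sets `s 0, s 1, …` have linear quotients along a path: a vertex `v` common to all the sets
up to `s i` is the only element of `s i` that `s (i + 1)` misses. Hence the ideal generated by the
monomials of `s 0, …, s i` has colon ideal `(x_v)` at the monomial of `s (i + 1)`. -/
def HasPathQuotients {n : ℕ} (s : Fin n → Finset V) : Prop :=
  ∀ i j : Fin n, i.val + 1 = j.val →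
    ∃ v, (∀ l ≤ i, v ∈ s l) ∧ v ∉ s j ∧ s i ∪ s j = insert v (s j)

variable {n : ℕ} {s : Fin n → Finset V}

theorem sqfree_sup_tsub {S T : Finset V} {v : V} (h : S ∪ T = insert v T) (hv : v ∉ T) :
    sqfree T ⊔ sqfree S - sqfree T = Finsupp.single v 1 := by
  rw [← sqfree_union, Finset.union_comm, h]
  rw [sqfree, Finset.sum_insert hv]
  exact add_tsub_cancel_right _ _

/-- The vertices of a Scarf path are resolved by its edges: a syzygy of the generators is reduced
from its last nonzero entry, which is divisible by the variable of the last colon ideal. -/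
theorem mem_range_of_boundary_eq_zero (hs : ∀ i j, s i ⊆ s j → i = j) (hne : ∀ i, (s i).Nonempty)
    (hpair : ∀ i j : Fin n, i.val + 1 = j.val →
      {sqfree (s j), sqfree (s i)} ∈ scarf (sqfreeIdeal k s))
    (hq : HasPathQuotients s) (y : Faces (scarf (sqfreeIdeal k s)) 1 →₀ MvPolynomial V k)
    (hy : homogenizedBoundary k (scarf (sqfreeIdeal k s)) 0 y = 0) :
    y ∈ LinearMap.range (homogenizedBoundary k (scarf (sqfreeIdeal k s)) 1) := by
  have hsurj' := fun σ => exists_image_of_mem_scarf (k := k) (σ := σ) hs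
  have hsingle : ∀ i, {sqfree (s i)} ∈ scarf (sqfreeIdeal k s) := fun i =>
    singleton_mem_scarf hs (hne i)
  generalize hΔ : scarf (sqfreeIdeal k s) = Δ at *
  let m : Fin n → Expo V := fun i => sqfree (s i)
  have hm : Function.Injective m := fun i j h => hs i j (sqfree_injective h).subset
  let e : Fin n → Faces Δ 1 := fun i => ⟨{m i}, hsingle i, Finset.card_singleton _⟩
  have hsurj : Function.Surjective e := fun ρ => by
    obtain ⟨T, hT⟩ := hsurj' ρ.1 ρ.2.1
    have hc := ρ.2.2
    rw [← hT, Finset.card_image_of_injective _ hm] at hc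
    obtain ⟨i, rfl⟩ := Finset.card_eq_one.1 hc
    exact ⟨i, Subtype.ext (by simpa using hT)⟩
  have h0 : Fin n → ∅ ∈ Δ := fun i => Δ.lower (by simp) (hsingle i)
  suffices H : ∀ j ≤ n, ∀ y : Faces Δ 1 →₀ MvPolynomial V k,
      (∀ i : Fin n, j ≤ i.val → y (e i) = 0) → homogenizedBoundary k Δ 0 y = 0 →
      y ∈ LinearMap.range (homogenizedBoundary k Δ 1) from
    H n le_rfl y (fun i hi => absurd i.2 (by omega)) hy
  intro j
  induction j with
  | zero =>
    intro _ y h _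
    have : y = 0 := by
      ext1 ρ
      obtain ⟨i, rfl⟩ := hsurj ρ
      exact h i (Nat.zero_le _)
    rw [this]
    exact zero_mem _
  | succ j ih =>
    intro hj y h hy
    let jj : Fin n := ⟨j, hj⟩
    have hsum : ∑ i, y (e i) * monomial (m i) 1 = 0 := by
      rw [homogenizedBoundary_zero_apply m hm e (fun _ => rfl) hsurj] at hy
      have := DFunLike.congr_fun hy ⟨∅, h0 jj, rfl⟩
      rwa [faceChain_apply, if_pos rfl] at this
    rw [← Finset.add_sum_erase _ _ (Finset.mem_univ jj)] at hsum
    rcases Nat.eq_zero_or_pos j with rfl | hj0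
    · refine ih (by omega) y (fun i _ => ?_) hy
      rw [Finset.sum_eq_zero, add_zero] at hsum
      · rcases Nat.eq_zero_or_pos i.val with hi | hi
        · obtain rfl : i = jj := Fin.ext hi
          simpa using hsum
        · exact h i hi
      · intro l hl
        rw [h l, zero_mul]
        have := Fin.val_ne_of_ne (Finset.ne_of_mem_erase hl)
        simp only [jj] at this
        omega
    · let ii : Fin n := ⟨j - 1, by omega⟩
      have hij : ii.val + 1 = jj.val := by simp only [ii, jj]; omega
      have hne' : m jj ≠ m ii := hm.ne (fun h => by rw [h] at hij; omega)
      obtain ⟨v, hv, hvj, hu⟩ := hq ii jj hij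
      -- All other terms of the syzygy are divisible by `X v`, hence so is this one.
      have hdvd : X v ∣ y (e jj) * monomial (m jj) 1 := by
        rw [eq_neg_of_add_eq_zero_left hsum, dvd_neg]
        refine Finset.dvd_sum fun l hl => ?_
        by_cases hlj : j + 1 ≤ l.val
        · simp [h l hlj]
        · refine Dvd.dvd.mul_left ?_ _
          rw [← prod_X_eq_monomial]
          refine Finset.dvd_prod_of_mem _ (hv l ?_)
          have := Fin.val_ne_of_ne (Finset.ne_of_mem_erase hl)
          simp only [jj] at this
          simp only [ii, Fin.le_def]
          omega
      have hdvd' : X v ∣ y (e jj) := by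
        refine (X_dvd_mul_iff.1 hdvd).resolve_right ?_
        rw [X_dvd_monomial]
        simp [m, sqfree_apply, hvj]
      obtain ⟨q, hqy⟩ := hdvd'
      obtain ⟨ε, -, hb⟩ := exists_homogenizedBoundary_edge (k := k) hne' (hpair ii jj hij)
      have hX : (monomial (m jj ⊔ m ii - m jj) 1 : MvPolynomial V k) = X v := by
        rw [sqfree_sup_tsub hu hvj]
        rfl
      -- Subtracting a multiple of the last edge removes the last entry of the syzygy.
      have key := ih (by omega)
        (y - homogenizedBoundary k Δ 1 (faceChain Δ 2 {m jj, m ii} (ε * q))) (fun l hl => by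
          rw [hb, hX, Finsupp.sub_apply, Finsupp.sub_apply, faceChain_apply, faceChain_apply]
          have hli : ({m ii} : Finset (Expo V)) ≠ (e l).1 := by
            simp only [e, ne_eq, Finset.singleton_inj, hm.eq_iff]
            rintro rfl
            simp only [ii] at hl
            omega
          rw [if_neg hli, sub_zero]
          rcases eq_or_lt_of_le hl with hl | hl
          · obtain rfl : l = jj := Fin.ext hl.symm
            rw [if_pos rfl, hqy]
            ring
          · have hlj : ({m jj} : Finset (Expo V)) ≠ (e l).1 := by
              simp only [e, ne_eq, Finset.singleton_inj, hm.eq_iff]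
              rintro rfl
              simp only [jj] at hl
              omega
            rw [if_neg hlj, h l hl, sub_zero])
        (by rw [map_sub, hy, homogenizedBoundary_comp, sub_zero])
      exact (Submodule.sub_mem_iff_left _ (LinearMap.mem_range_self _ _)).1 key

/-- The edges of a Scarf path have no syzygies: the first edge is the only one at its first
vertex. -/
theorem eq_zero_of_boundary_eq_zero (hs : ∀ i j, s i ⊆ s j → i = j)
    (hedge : ∀ σ : Faces (scarf (sqfreeIdeal k s)) 2,
      ∃ i j : Fin n, i.val + 1 = j.val ∧ σ.1 = {sqfree (s i), sqfree (s j)})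
    (z : Faces (scarf (sqfreeIdeal k s)) 2 →₀ MvPolynomial V k)
    (hz : homogenizedBoundary k (scarf (sqfreeIdeal k s)) 1 z = 0) : z = 0 := by
  have hinj : ∀ i j, sqfree (s i) = sqfree (s j) → i = j := fun i j h =>
    hs i j (sqfree_injective h).subset
  generalize scarf (sqfreeIdeal k s) = Δ at *
  suffices H : ∀ (a : ℕ) (i j : Fin n) (σ : Faces Δ 2), i.val = a → i.val + 1 = j.val →
      σ.1 = {sqfree (s i), sqfree (s j)} → z σ = 0 by
    ext1 σ
    obtain ⟨i, j, hij, hσ⟩ := hedge σ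
    exact H _ i j σ rfl hij hσ
  intro a
  induction a using Nat.strong_induction_on with
  | _ a ih =>
    rintro i j σ rfl hij hσ
    have hne : sqfree (s i) ≠ sqfree (s j) := fun h => by
      rw [hinj _ _ h] at hij
      omega
    have hmem : {sqfree (s i)} ∈ Δ := Δ.lower (by simp [hσ]) σ.2.1
    have h := DFunLike.congr_fun hz ⟨{sqfree (s i)}, hmem, Finset.card_singleton _⟩
    have e1 : ({sqfree (s i), sqfree (s j)} : Finset (Expo V)).erase (sqfree (s i)) =
        {sqfree (s j)} := by
      rw [Finset.erase_insert (by simpa using hne)]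
    have e2 : ({sqfree (s i), sqfree (s j)} : Finset (Expo V)).erase (sqfree (s j)) =
        {sqfree (s i)} := by
      rw [Finset.pair_comm, Finset.erase_insert (by simpa using hne.symm)]
    rw [homogenizedBoundary, boundary_apply, Finsupp.sum, Finset.sum_eq_single σ] at h
    · simp only [hσ] at h
      rw [Finset.sum_pair hne, e1, e2, if_neg (by simpa using hne.symm), if_pos rfl,
        zero_add] at h
      have hsign : sign (MvPolynomial V k) {sqfree (s i), sqfree (s j)} (sqfree (s j)) ≠ 0 :=
        fun h0 => by
          have h1 := sign_mul_self (R := MvPolynomial V k) {sqfree (s i), sqfree (s j)}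
            (sqfree (s j))
          rw [h0, zero_mul] at h1
          exact zero_ne_one h1
      simpa [hsign] using h
    · intro τ _ hτ
      obtain ⟨b, c, hbc, hτ'⟩ := hedge τ
      refine Finset.sum_eq_zero fun v hv => ?_
      split_ifs with hv'
      swap
      · rfl
      have hi : sqfree (s i) ∈ τ.1 := Finset.erase_subset v _ (hv' ▸ Finset.mem_singleton_self _)
      rw [hτ', Finset.mem_insert, Finset.mem_singleton] at hi
      rcases hi with hi | hi
      · obtain rfl := hinj _ _ hi
        obtain rfl : j = c := Fin.ext (by omega)
        exact absurd (Subtype.ext (hτ'.trans hσ.symm)) hτ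
      · obtain rfl := hinj _ _ hi
        rw [ih b.val (by omega) b i τ rfl hbc hτ', zero_mul]
    · intro hσ'
      simp [Finsupp.notMem_support_iff.1 hσ']

/-- As there are no faces with three vertices, exactness has to be checked only at the empty face,
at the vertices and at the edges. -/
theorem isScarf_of_path (h : EncodesGraph s (SimpleGraph.pathGraph n))
    (hpath : IsPath (scarf (sqfreeIdeal k s)) n) (hq : HasPathQuotients s) :
    IsScarf (sqfreeIdeal k s) := by
  have hs := h.antichain
  have h0 : ∅ ∈ scarf (sqfreeIdeal k s) := by
    obtain ⟨f, hf⟩ := hpath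
    exact (hf ∅).2 (Or.inl (by simp))
  have hbig : ∀ l, IsEmpty (Faces (scarf (sqfreeIdeal k s)) (l + 3)) := fun l => ⟨fun σ => by
    have := hpath.card_le σ.2.1
    have := σ.2.2
    omega⟩
  have hedge : ∀ σ : Faces (scarf (sqfreeIdeal k s)) 2,
      ∃ i j : Fin n, i.val + 1 = j.val ∧ σ.1 = {sqfree (s i), sqfree (s j)} := fun σ => by
    obtain ⟨T, hT⟩ := exists_image_of_mem_scarf hs σ.2.1
    have hc := σ.2.2
    rw [← hT, Finset.card_image_of_injective _ fun i j h =>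
      hs i j (sqfree_injective h).subset] at hc
    obtain ⟨i, j, hij, rfl⟩ := Finset.card_eq_two.1 hc
    have hadj : (SimpleGraph.pathGraph n).Adj i j := by
      by_contra hn
      obtain ⟨l, hl, h1, h2⟩ := h.of_not_adj i j hij hn
      have := eq_or_eq_of_mem_scarf hs (hT ▸ σ.2.1) (by simp) (by simp) hl
      tauto
    rw [SimpleGraph.pathGraph_adj] at hadj
    rcases hadj with hadj | hadj
    · exact ⟨i, j, hadj, by simp [← hT, Finset.image_insert]⟩
    · exact ⟨j, i, hadj, by simp [← hT, Finset.image_insert, Finset.pair_comm]⟩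
  refine ⟨fun l => ?_, exact_augmentation_scarf hs h.nonempty h0, augmentation_surjective _ h0⟩
  match l with
  | 0 =>
    refine fun y => ⟨fun hy => mem_range_of_boundary_eq_zero hs h.nonempty (fun i j hij => ?_) hq y
      hy, ?_⟩
    · have hadj : (SimpleGraph.pathGraph n).Adj j i :=
        SimpleGraph.pathGraph_adj.2 (Or.inr hij)
      exact pair_mem_scarf hs hadj.ne fun l => h.of_adj j i l hadj
    · rintro ⟨z, rfl⟩
      exact homogenizedBoundary_comp _ z
  | 1 =>
    have := hbig 0
    refine fun z => ⟨fun hz => ⟨0, ?_⟩, ?_⟩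
    · rw [map_zero]
      exact (eq_zero_of_boundary_eq_zero hs hedge z hz).symm
    · rintro ⟨w, rfl⟩
      rw [Subsingleton.elim w 0, map_zero, map_zero]
  | l + 2 =>
    have := hbig l
    have := hbig (l + 1)
    refine fun z => ⟨fun _ => ⟨0, Subsingleton.elim _ _⟩, fun _ => ?_⟩
    rw [Subsingleton.elim z 0, map_zero]

end PathResolution

/-! ### Connected vertex sets of paths and cycles -/

section Arcs

open SimpleGraph

theorem cycleGraph_adj_iff_val {n : ℕ} (hn : 2 ≤ n) {u v : Fin n} :
    (cycleGraph n).Adj u v ↔ u.val + 1 = v.val ∨ v.val + 1 = u.val ∨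
      (u.val = 0 ∧ v.val + 1 = n) ∨ (v.val = 0 ∧ u.val + 1 = n) := by
  rw [cycleGraph_adj']
  have hu := u.2
  have hv := v.2
  rcases le_total u v with h | h
  · rcases eq_or_lt_of_le h with rfl | h'
    · rw [Fin.sub_val_of_le le_rfl]
      omega
    · rw [Fin.sub_val_of_le h, Fin.coe_sub_iff_lt.2 h']
      have : u.val < v.val := h'
      omega
  · rcases eq_or_lt_of_le h with rfl | h'
    · rw [Fin.sub_val_of_le le_rfl]
      omega
    · rw [Fin.sub_val_of_le h, Fin.coe_sub_iff_lt.2 h']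
      have : v.val < u.val := h'
      omega

theorem cycleGraph_triangle_free {n : ℕ} (hn : 4 ≤ n) (i j l : Fin n)
    (hij : (cycleGraph n).Adj i j) (hjl : (cycleGraph n).Adj j l) : ¬ (cycleGraph n).Adj i l := by
  rw [cycleGraph_adj_iff_val (by omega)] at *
  omega

theorem pathGraph_triangle_free {n : ℕ} (i j l : Fin n)
    (hij : (pathGraph n).Adj i j) (hjl : (pathGraph n).Adj j l) : ¬ (pathGraph n).Adj i l := by
  rw [pathGraph_adj] at *
  omega

theorem induce_connected_of_sequence {V : Type*} {G : SimpleGraph V} {S : Set V} {t : ℕ}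
    (ht : 0 < t) (g : ℕ → V) (hg : ∀ j < t, g j ∈ S) (hS : ∀ v ∈ S, ∃ j < t, g j = v)
    (hadj : ∀ j, j + 1 < t → G.Adj (g j) (g (j + 1))) : (G.induce S).Connected := by
  rw [connected_iff_exists_forall_reachable]
  refine ⟨⟨g 0, hg 0 ht⟩, ?_⟩
  have H : ∀ j (hj : j < t), (G.induce S).Reachable ⟨g 0, hg 0 ht⟩ ⟨g j, hg j hj⟩ := by
    intro j
    induction j with
    | zero => exact fun _ => Reachable.refl _
    | succ j ih =>
      intro hj
      refine (ih (by omega)).trans (Adj.reachable ?_)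
      exact hadj j hj
  rintro ⟨v, hv⟩
  obtain ⟨j, hj, rfl⟩ := hS v hv
  exact H j hj

/-- A connected set `S` that can only be left forwards along the sequence `g` contains the first
`|S|` terms of `g`: otherwise the terms before the first gap would be a component of `S`. -/
theorem mem_of_induce_connected {V : Type*} [DecidableEq V] {G : SimpleGraph V} {S : Finset V}
    (hS : (G.induce (S : Set V)).Connected) (g : ℕ → V) (h0 : g 0 ∈ S)
    (hadj : ∀ j, j + 1 ≤ S.card → ∀ b ∈ S, G.Adj (g j) b → ∃ i ≤ j + 1, g i = b) :
    ∀ j < S.card, g j ∈ S := by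
  intro j
  induction j using Nat.strong_induction_on with
  | _ j ih =>
    intro hj
    rcases Nat.eq_zero_or_pos j with rfl | hj0
    · exact h0
    by_contra hgj
    have closed : ∀ (u v : (S : Set V)), (G.induce (S : Set V)).Walk u v →
        (∃ i < j, g i = u) → ∃ i < j, g i = v := by
      intro u v p
      induction p with
      | nil => exact id
      | @cons u w v huw _ ihp =>
        rintro ⟨i, hi, hiu⟩
        refine ihp ?_
        have huw' : G.Adj (g i) w := hiu ▸ huw
        obtain ⟨i', hi', hw⟩ := hadj i (by omega) w w.2 huw'
        refine ⟨i', lt_of_le_of_ne (by omega) ?_, hw⟩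
        rintro rfl
        exact hgj (hw ▸ w.2)
    have hsub : S ⊆ (Finset.range j).image g := by
      intro v hv
      obtain ⟨p⟩ := hS.preconnected ⟨g 0, h0⟩ ⟨v, hv⟩
      obtain ⟨i, hi, rfl⟩ := closed _ _ p ⟨0, hj0, rfl⟩
      exact Finset.mem_image_of_mem g (Finset.mem_range.2 hi)
    have := (Finset.card_le_card hsub).trans Finset.card_image_le
    rw [Finset.card_range] at this
    omega

/-- The arc of `t` consecutive elements of `Fin r` that starts at `i`, wrapping around at `r`. -/
def arc (r t i : ℕ) : Finset (Fin r) :=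
  Finset.univ.filter fun v => (i ≤ v.val ∧ v.val < i + t) ∨ v.val + r < i + t

theorem mem_arc {r t i : ℕ} {v : Fin r} :
    v ∈ arc r t i ↔ (i ≤ v.val ∧ v.val < i + t) ∨ v.val + r < i + t := by
  simp [arc]

theorem arc_subset_union {r t i j l : ℕ} : arc r t l ⊆ arc r t i ∪ arc r t j ↔
    ∀ v < r, ((l ≤ v ∧ v < l + t) ∨ v + r < l + t) →
      ((i ≤ v ∧ v < i + t) ∨ v + r < i + t) ∨ ((j ≤ v ∧ v < j + t) ∨ v + r < j + t) := by
  simp only [Finset.subset_iff, Finset.mem_union, mem_arc, Fin.forall_iff]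

theorem arc_subset {r t i l : ℕ} : arc r t l ⊆ arc r t i ↔
    ∀ v < r, ((l ≤ v ∧ v < l + t) ∨ v + r < l + t) →
      ((i ≤ v ∧ v < i + t) ∨ v + r < i + t) := by
  simp only [Finset.subset_iff, mem_arc, Fin.forall_iff]

theorem arc_nonempty {r t i : ℕ} (ht : 0 < t) (hi : i < r) : (arc r t i).Nonempty :=
  ⟨⟨i, hi⟩, mem_arc.2 (by simp [ht])⟩

theorem arc_antichain {r t i j : ℕ} (ht : 0 < t) (htr : t < r) (hi : i < r) (hj : j < r)
    (h : arc r t i ⊆ arc r t j) : i = j := by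
  rw [arc_subset] at h
  -- If `i ≠ j`, one of the ends of the arc at `i` or the predecessor of `j` modulo `r` lies in the
  -- first arc but not in the second.
  have h1 := h i
  have h2 := h (j - 1)
  have h3 := h (r - 1)
  have h4 := h (i + t - 1)
  have h5 := h (i + t - 1 - r)
  omega

theorem ofNat_add_val {r i j : ℕ} [NeZero r] (hi : i < r) (hj : j ≤ r) :
    (i + j < r ∧ (Fin.ofNat r (i + j)).val = i + j) ∨
      (r ≤ i + j ∧ (Fin.ofNat r (i + j)).val + r = i + j) := by
  rw [Fin.val_ofNat]
  by_cases h : i + j < r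
  · rw [Nat.mod_eq_of_lt h]
    omega
  · rw [Nat.mod_eq_sub_mod (by omega), Nat.mod_eq_of_lt (by omega)]
    omega

theorem arc_eq_image {r t i : ℕ} [NeZero r] (hi : i < r) (ht : t ≤ r) :
    arc r t i = (Finset.range t).image fun j => Fin.ofNat r (i + j) := by
  ext v
  have hv := v.2
  simp only [mem_arc, Finset.mem_image, Finset.mem_range]
  constructor
  · rintro (h | h)
    · refine ⟨v.val - i, by omega, Fin.ext ?_⟩
      have := ofNat_add_val (r := r) (j := v.val - i) hi (by omega)
      omega
    · refine ⟨v.val + r - i, by omega, Fin.ext ?_⟩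
      have := ofNat_add_val (r := r) (j := v.val + r - i) hi (by omega)
      omega
  · rintro ⟨j, hj, rfl⟩
    have := ofNat_add_val (r := r) (j := j) hi (by omega)
    omega

theorem card_arc {r t i : ℕ} (hi : i < r) (ht : t ≤ r) : (arc r t i).card = t := by
  have : NeZero r := ⟨by omega⟩
  rw [arc_eq_image hi ht, Finset.card_image_of_injOn, Finset.card_range]
  intro a ha b hb hab
  simp only [Finset.coe_range, Set.mem_Iio] at ha hb
  have h1 := ofNat_add_val (r := r) (j := a) hi (by omega)
  have h2 := ofNat_add_val (r := r) (j := b) hi (by omega)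
  have := congrArg Fin.val hab
  simp only at this
  omega

theorem arc_connected {r t i : ℕ} [NeZero r] {G : SimpleGraph (Fin r)} (ht : 0 < t) (hi : i < r)
    (htr : t ≤ r)
    (hG : ∀ j, j + 1 < t → G.Adj (Fin.ofNat r (i + j)) (Fin.ofNat r (i + (j + 1)))) :
    (G.induce (arc r t i : Set (Fin r))).Connected := by
  rw [arc_eq_image hi htr]
  refine induce_connected_of_sequence ht (fun j => Fin.ofNat r (i + j)) (fun j hj => ?_)
    (fun v hv => ?_) hG
  · exact Finset.mem_coe.2 (Finset.mem_image_of_mem _ (Finset.mem_range.2 hj))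
  · simpa using hv

theorem eq_arc_of_mem {r t i : ℕ} [NeZero r] (hi : i < r) (htr : t ≤ r) {S : Finset (Fin r)}
    (hS : S.card = t) (h : ∀ j < S.card, Fin.ofNat r (i + j) ∈ S) : arc r t i = S := by
  refine Finset.eq_of_subset_of_card_le ?_ (by rw [hS, card_arc hi htr])
  rw [arc_eq_image hi htr, Finset.image_subset_iff]
  intro j hj
  exact h j (by simpa [hS] using hj)

theorem connected_pathGraph_iff {r t : ℕ} (ht : 0 < t) (S : Finset (Fin r)) :
    S.card = t ∧ ((pathGraph r).induce (S : Set (Fin r))).Connected ↔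
      ∃ i : Fin (r + 1 - t), arc r t i = S := by
  constructor
  · rintro ⟨hcard, hS⟩
    have hne : S.Nonempty := Finset.card_pos.1 (by omega)
    set m := S.min' hne
    have hm : m ∈ S := S.min'_mem hne
    have : NeZero r := ⟨fun h => by have := m.2; omega⟩
    have hmin : ∀ v ∈ S, m.val ≤ v.val := fun v hv => S.min'_le v hv
    have hle : t ≤ r - m.val := by
      rw [← hcard, ← Fin.card_Ici]
      exact Finset.card_le_card fun v hv => Finset.mem_Ici.2 (S.min'_le v hv)
    have hm' := m.2
    refine ⟨⟨m.val, by omega⟩, eq_arc_of_mem hm' (by omega) hcard ?_⟩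
    refine mem_of_induce_connected hS _ (by simpa using hm) ?_
    intro j hj b hb hadj
    have h1 := ofNat_add_val (r := r) (j := j) hm' (by omega)
    have hb' := hmin b hb
    have hb2 := b.2
    rw [pathGraph_adj] at hadj
    rcases hadj with hadj | hadj
    · refine ⟨j + 1, le_rfl, Fin.ext ?_⟩
      have h2 := ofNat_add_val (r := r) (j := j + 1) hm' (by omega)
      omega
    · refine ⟨j - 1, by omega, Fin.ext ?_⟩
      have h2 := ofNat_add_val (r := r) (j := j - 1) hm' (by omega)
      omega
  · rintro ⟨i, rfl⟩
    have hi := i.2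
    have : NeZero r := ⟨by omega⟩
    refine ⟨card_arc (by omega) (by omega), arc_connected ht (by omega) (by omega) ?_⟩
    intro j hj
    have h1 := ofNat_add_val (r := r) (i := i.val) (j := j) (by omega) (by omega)
    have h2 := ofNat_add_val (r := r) (i := i.val) (j := j + 1) (by omega) (by omega)
    rw [pathGraph_adj]
    omega

/-- A proper nonempty subset of the cycle has an element whose predecessor is missing. -/
theorem exists_mem_pred_notMem {r : ℕ} {S : Finset (Fin r)} (hne : S.Nonempty)
    (huniv : S ≠ Finset.univ) : ∃ i p : Fin r, i ∈ S ∧ p ∉ S ∧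
      (p.val + 1 = i.val ∨ (i.val = 0 ∧ p.val + 1 = r)) := by
  have hc : Sᶜ.Nonempty := by
    rwa [Finset.nonempty_iff_ne_empty, ne_eq, Finset.compl_eq_empty_iff]
  have hm : S.min' hne ∈ S := S.min'_mem hne
  have hp : Sᶜ.max' hc ∉ S := Finset.mem_compl.1 (Sᶜ.max'_mem hc)
  have hmin : ∀ v ∈ S, (S.min' hne).val ≤ v.val := fun v hv => S.min'_le v hv
  have hmax : ∀ v ∉ S, v.val ≤ (Sᶜ.max' hc).val := fun v hv =>
    Sᶜ.le_max' v (Finset.mem_compl.2 hv)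
  generalize S.min' hne = m at *
  generalize Sᶜ.max' hc = p at *
  have hp2 := p.2
  have hm2 := m.2
  by_cases h1 : p.val + 1 < r
  · refine ⟨⟨p.val + 1, h1⟩, p, ?_, hp, Or.inl rfl⟩
    by_contra h
    have := hmax _ h
    simp only at this
    omega
  · by_cases h2 : m.val = 0
    · exact ⟨m, p, hm, hp, Or.inr ⟨h2, by omega⟩⟩
    · refine ⟨m, ⟨m.val - 1, by omega⟩, hm, fun h => ?_, Or.inl (by simp only; omega)⟩
      have := hmin _ h
      simp only at this
      omega

theorem connected_cycleGraph_iff {r t : ℕ} (ht : 2 ≤ t) (htr : t < r) (S : Finset (Fin r)) :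
    S.card = t ∧ ((cycleGraph r).induce (S : Set (Fin r))).Connected ↔
      ∃ i : Fin r, arc r t i = S := by
  have : NeZero r := ⟨by omega⟩
  constructor
  · rintro ⟨hcard, hS⟩
    obtain ⟨m, p, hm, hp, hmp⟩ := exists_mem_pred_notMem (S := S)
      (Finset.card_pos.1 (by omega)) (by
        rintro rfl
        simp at hcard
        omega)
    have hm' := m.2
    refine ⟨m, eq_arc_of_mem hm' htr.le hcard ?_⟩
    refine mem_of_induce_connected hS _ (by simpa using hm) ?_
    intro j hj b hb hadj
    have h1 := ofNat_add_val (r := r) (j := j) hm' (by omega)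
    have hbp : b.val ≠ p.val := fun h => hp (Fin.ext h ▸ hb)
    have hb2 := b.2
    rw [cycleGraph_adj_iff_val (by omega)] at hadj
    have h2 := ofNat_add_val (r := r) (j := j + 1) hm' (by omega)
    have h3 := ofNat_add_val (r := r) (j := j - 1) hm' (by omega)
    by_cases hb3 : (Fin.ofNat r (m.val + (j + 1))).val = b.val
    · exact ⟨j + 1, le_rfl, Fin.ext hb3⟩
    · exact ⟨j - 1, by omega, Fin.ext (by omega)⟩
  · rintro ⟨i, rfl⟩
    have hi := i.2
    refine ⟨card_arc (by omega) (by omega), arc_connected (by omega) (by omega) (by omega) ?_⟩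
    intro j hj
    have h1 := ofNat_add_val (r := r) (i := i.val) (j := j) (by omega) (by omega)
    have h2 := ofNat_add_val (r := r) (i := i.val) (j := j + 1) (by omega) (by omega)
    rw [cycleGraph_adj_iff_val (by omega)]
    omega

theorem connectedIdeal_eq_sqfreeIdeal (k : Type*) [Field k] {V ι : Type*} {G : SimpleGraph V}
    {t : ℕ} {s : ι → Finset V}
    (h : ∀ S : Finset V, S.card = t ∧ (G.induce (S : Set V)).Connected ↔ ∃ i, s i = S) :
    connectedIdeal k G t = sqfreeIdeal k s := by
  rw [connectedIdeal, sqfreeIdeal]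
  congr 1
  ext p
  constructor
  · rintro ⟨S, hS, hS', rfl⟩
    obtain ⟨i, rfl⟩ := (h S).1 ⟨hS, hS'⟩
    exact ⟨i, (prod_X_eq_monomial _).symm⟩
  · rintro ⟨i, rfl⟩
    obtain ⟨h1, h2⟩ := (h (s i)).2 ⟨i, rfl⟩
    exact ⟨s i, h1, h2, (prod_X_eq_monomial _).symm⟩

/-- For `r ≤ t` the only candidate for a generator is the set of all vertices. -/
theorem connectedIdeal_cycleGraph_of_le (k : Type*) [Field k] {r t : ℕ} (hr : 0 < r)
    (h : r ≤ t) : connectedIdeal k (cycleGraph r) t = connectedIdeal k (pathGraph r) t := by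
  have key : ∀ G : SimpleGraph (Fin r), G.Connected → ∀ S : Finset (Fin r), S.card = t →
      (G.induce (S : Set (Fin r))).Connected := by
    intro G hG S hS
    have : S = Finset.univ := by
      rw [← Finset.card_eq_iff_eq_univ, Fintype.card_fin]
      have := S.card_le_univ
      rw [Fintype.card_fin] at this
      omega
    rw [this, Finset.coe_univ]
    exact (induceUnivIso G).connected_iff.2 hG
  obtain ⟨n, rfl⟩ := Nat.exists_eq_succ_of_ne_zero hr.ne'
  have hc := key _ cycleGraph_connected
  have hp := key _ (pathGraph_connected n)
  rw [connectedIdeal, connectedIdeal]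
  congr 1
  ext p
  constructor
  · rintro ⟨S, h1, -, h2⟩
    exact ⟨S, h1, hp S h1, h2⟩
  · rintro ⟨S, h1, -, h2⟩
    exact ⟨S, h1, hc S h1, h2⟩

end Arcs

/-! ### Scarf graphs of families of arcs -/

section ArcFamilies

open SimpleGraph

theorem encodesGraph_path {r t : ℕ} (ht : 0 < t) (hr : r ≤ 2 * t) :
    EncodesGraph (fun i : Fin (r + 1 - t) => arc r t i) (pathGraph (r + 1 - t)) where
  nonempty i := arc_nonempty ht (by omega)
  antichain i j h := by
    rw [arc_subset] at h
    have h1 := h i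
    have h2 := h (i + t - 1)
    omega
  of_adj i j l hij h := by
    rw [pathGraph_adj] at hij
    rw [arc_subset_union] at h
    have h1 := h l
    have h2 := h (l + t - 1)
    simp only [Fin.ext_iff]
    omega
  of_not_adj i j hne hij := by
    rw [pathGraph_adj] at hij
    have hne' := Fin.val_ne_of_ne hne
    simp only [arc_subset_union, ne_eq, Fin.ext_iff]
    rcases lt_or_gt_of_ne hne' with h | h
    · exact ⟨⟨i + 1, by omega⟩, fun v hv h => by simp only at h; omega, by simp, by simp; omega⟩
    · exact ⟨⟨j + 1, by omega⟩, fun v hv h => by simp only at h; omega, by simp; omega, by simp⟩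

theorem hasPathQuotients_arc {r t : ℕ} (ht : 0 < t) (hr : r ≤ 2 * t) :
    HasPathQuotients fun i : Fin (r + 1 - t) => arc r t i := by
  intro i j hij
  have hj := j.2
  refine ⟨⟨i, by omega⟩, fun l hl => ?_, ?_, ?_⟩
  · rw [Fin.le_def] at hl
    rw [mem_arc]
    simp only
    omega
  · rw [mem_arc]
    simp only
    omega
  · ext v
    simp only [Finset.mem_union, Finset.mem_insert, mem_arc, Fin.ext_iff]
    omega

/-- The first `t + 2` arcs form a polygon: the outer two miss the vertex `t` between them, which
every other arc of the family contains. -/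
theorem encodesGraph_cycle_of_le {r t : ℕ} (ht : 2 ≤ t) (hr : 2 * t + 1 ≤ r) :
    EncodesGraph (fun i : Fin (t + 2) => arc r t i) (cycleGraph (t + 2)) where
  nonempty i := arc_nonempty (by omega) (by omega)
  antichain i j h := Fin.ext (arc_antichain (by omega) (by omega) (by omega) (by omega) h)
  of_adj i j l hij h := by
    rw [cycleGraph_adj_iff_val (by omega)] at hij
    rw [arc_subset_union] at h
    have h1 := h l
    have h2 := h (l + t - 1)
    have h3 := h t
    simp only [Fin.ext_iff]
    omega
  of_not_adj i j hne hij := by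
    rw [cycleGraph_adj_iff_val (by omega)] at hij
    have hne' := Fin.val_ne_of_ne hne
    simp only [arc_subset_union, ne_eq, Fin.ext_iff]
    rcases lt_or_gt_of_ne hne' with h | h
    · exact ⟨⟨i + 1, by omega⟩, fun v hv h => by simp only at h; omega, by simp, by simp; omega⟩
    · exact ⟨⟨j + 1, by omega⟩, fun v hv h => by simp only at h; omega, by simp; omega, by simp⟩

/-- Two consecutive arcs miss the vertex that follows them, while any third arc that starts in
their union contains that vertex. -/
theorem eq_or_eq_of_arc_subset {r t i j l : ℕ} (ht : 2 ≤ t) (hr : t + 2 ≤ r) (hi : i < r)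
    (hj : j < r) (hl : l < r) (hij : i + 1 = j ∨ (j = 0 ∧ i + 1 = r))
    (h : arc r t l ⊆ arc r t i ∪ arc r t j) : l = i ∨ l = j := by
  rw [arc_subset_union] at h
  have h1 := h l hl
  by_cases hw : j + t < r
  · have h2 := h (j + t) hw
    omega
  · have h2 := h (j + t - r) (by omega)
    omega

theorem exists_arc_subset {r t i j : ℕ} (hr : r ≤ 2 * t + 1) (hij : i + 1 < j) (hj : j < r)
    (hji : j + 1 < r + i) :
    ∃ l, l < r ∧ arc r t l ⊆ arc r t i ∪ arc r t j ∧ l ≠ i ∧ l ≠ j := by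
  simp only [arc_subset_union]
  -- The shorter of the two gaps between `i` and `j` is at most `t`.
  by_cases h : j ≤ i + t
  · exact ⟨i + 1, by omega, fun v hv h => by omega, by omega, by omega⟩
  · by_cases hw : j + 1 < r
    · exact ⟨j + 1, hw, fun v hv h => by omega, by omega, by omega⟩
    · exact ⟨0, by omega, fun v hv h => by omega, by omega, by omega⟩

theorem encodesGraph_cycle {r t : ℕ} (ht : 2 ≤ t) (h1 : t + 2 ≤ r) (h2 : r ≤ 2 * t + 1) :
    EncodesGraph (fun i : Fin r => arc r t i) (cycleGraph r) where
  nonempty i := arc_nonempty (by omega) (by omega)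
  antichain i j h := Fin.ext (arc_antichain (by omega) (by omega) (by omega) (by omega) h)
  of_adj i j l hij h := by
    rw [cycleGraph_adj_iff_val (by omega)] at hij
    simp only [Fin.ext_iff]
    by_cases hd : i.val + 1 = j.val ∨ (j.val = 0 ∧ i.val + 1 = r)
    · exact eq_or_eq_of_arc_subset ht h1 i.2 j.2 l.2 hd h
    · rw [Finset.union_comm] at h
      exact (eq_or_eq_of_arc_subset ht h1 j.2 i.2 l.2 (by omega) h).symm
  of_not_adj i j hne hij := by
    rw [cycleGraph_adj_iff_val (by omega)] at hij
    have hne' := Fin.val_ne_of_ne hne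
    simp only [ne_eq, Fin.ext_iff]
    rcases lt_or_gt_of_ne hne' with h | h
    · obtain ⟨l, hl, h3, h4, h5⟩ := exists_arc_subset (i := i) (j := j) h2 (by omega) j.2
        (by omega)
      exact ⟨⟨l, hl⟩, h3, h4, h5⟩
    · obtain ⟨l, hl, h3, h4, h5⟩ := exists_arc_subset (i := j) (j := i) h2 (by omega) i.2
        (by omega)
      exact ⟨⟨l, hl⟩, Finset.union_comm (arc r t j) _ ▸ h3, h5, h4⟩

/-- On the cycle with `t + 1` vertices any two arcs cover everything. -/
theorem encodesGraph_bot {t : ℕ} (ht : 2 ≤ t) :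
    EncodesGraph (fun i : Fin (t + 1) => arc (t + 1) t i) ⊥ where
  nonempty i := arc_nonempty (by omega) i.2
  antichain i j h := Fin.ext (arc_antichain (by omega) (by omega) (by omega) (by omega) h)
  of_adj i j l hij := hij.elim
  of_not_adj i j hne _ := by
    have hne' := Fin.val_ne_of_ne hne
    have hl : ∃ l : Fin (t + 1), l ≠ i ∧ l ≠ j := by
      by_contra! h
      have := Finset.card_le_card (show (Finset.univ : Finset (Fin (t + 1))) ⊆ {i, j} from
        fun l _ => by
          by_cases hl : l = i
          · simp [hl]
          · simp [h l hl])
      rw [Finset.card_univ, Fintype.card_fin] at this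
      have := this.trans Finset.card_le_two
      omega
    obtain ⟨l, hli, hlj⟩ := hl
    refine ⟨l, ?_, hli, hlj⟩
    rw [arc_subset_union]
    intro v hv _
    omega

/-- Among the first `n` arcs, those inside the first `2t + 1` vertices are the first `t + 2`. The
last hypothesis excludes arcs that wrap around at `r` without leaving these vertices: either none
of the `n` arcs wraps around, or a wrapping arc contains the vertex `r - 1 ≥ 2t + 1`. -/
theorem mem_range_castLE_iff {r t n : ℕ} (ht : 0 < t) (hr : 2 * t + 1 ≤ r) (hn : t + 2 ≤ n)
    (hnr : n ≤ r) (hwrap : n + t ≤ r + 1 ∨ 2 * t + 2 ≤ r) (l : Fin n) :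
    arc r t l ⊆ (Finset.univ.filter fun v : Fin r => v.val < 2 * t + 1) ↔
      l ∈ Set.range (Fin.castLEEmb hn) := by
  simp only [Finset.subset_iff, mem_arc, Finset.mem_filter, Finset.mem_univ, true_and,
    Fin.forall_iff, Set.mem_range]
  have hl := l.2
  constructor
  · intro h
    have h1 := h l.val (by omega) (by omega)
    have hlt : l.val < t + 2 := by
      by_contra hlt
      have h2 := h (2 * t + 1)
      omega
    exact ⟨⟨l.val, hlt⟩, rfl⟩
  · rintro ⟨⟨m, hm⟩, rfl⟩ v hv h
    simp only [Fin.castLEEmb_apply, Fin.castLE_mk] at h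
    omega

theorem not_isScarf_of_first_arcs (k : Type*) [Field k] {r t n : ℕ} (ht : 2 ≤ t)
    (hr : 2 * t + 1 ≤ r) (hn : t + 2 ≤ n) (hnr : n ≤ r)
    (hwrap : n + t ≤ r + 1 ∨ 2 * t + 2 ≤ r) :
    ¬ IsScarf (sqfreeIdeal k fun i : Fin n => arc r t i) := by
  obtain ⟨N, rfl⟩ := Nat.exists_eq_add_of_le' ht
  exact not_isScarf_of_polygon
    (fun i j h => Fin.ext (arc_antichain (by omega) (by omega) (by omega) (by omega) h))
    (N := N + 1) (Fin.castLEEmb hn) (encodesGraph_cycle_of_le ht hr)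
    (cycleGraph_triangle_free (by omega)) _ (mem_range_castLE_iff (by omega) hr hn hnr hwrap)

end ArcFamilies

end ScarfPC

theorem mainTheorem3 (k : Type*) [Field k] (r t : ℕ) (hr : 3 ≤ r) (ht : 3 ≤ t) :
    (ScarfPC.IsScarf (ScarfPC.connectedIdeal k (SimpleGraph.pathGraph r) t) ↔ r ≤ 2 * t) ∧
    (ScarfPC.IsScarf (ScarfPC.connectedIdeal k (SimpleGraph.cycleGraph r) t) ↔ r ≤ t) ∧
    (r ≤ 2 * t →
      ScarfPC.IsPath (ScarfPC.scarf (ScarfPC.connectedIdeal k (SimpleGraph.pathGraph r) t))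
        (r + 1 - t)) ∧
    (r = 2 * t + 1 →
      ScarfPC.IsHollowPolygon
        (ScarfPC.scarf (ScarfPC.connectedIdeal k (SimpleGraph.pathGraph r) t)) (t + 2) ∧
      Nontrivial (ScarfPC.Homology k
        (ScarfPC.scarf (ScarfPC.connectedIdeal k (SimpleGraph.pathGraph r) t)) 1)) ∧
    (r = t + 1 →
      ScarfPC.IsDiscrete
        (ScarfPC.scarf (ScarfPC.connectedIdeal k (SimpleGraph.cycleGraph r) t)) (t + 1)) ∧
    (t + 2 ≤ r → r ≤ 2 * t + 1 →
      ScarfPC.IsHollowPolygon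
        (ScarfPC.scarf (ScarfPC.connectedIdeal k (SimpleGraph.cycleGraph r) t)) r ∧
      Nontrivial (ScarfPC.Homology k
        (ScarfPC.scarf (ScarfPC.connectedIdeal k (SimpleGraph.cycleGraph r) t)) 1)) := by
  open ScarfPC in
  have hP : connectedIdeal k (SimpleGraph.pathGraph r) t =
      sqfreeIdeal k fun i : Fin (r + 1 - t) => arc r t i :=
    connectedIdeal_eq_sqfreeIdeal k (connected_pathGraph_iff (by omega))
  have hC : t < r → connectedIdeal k (SimpleGraph.cycleGraph r) t =
      sqfreeIdeal k fun i : Fin r => arc r t i := fun h =>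
    connectedIdeal_eq_sqfreeIdeal k (connected_cycleGraph_iff (by omega) h)
  have hpath : r ≤ 2 * t →
      IsPath (scarf (connectedIdeal k (SimpleGraph.pathGraph r) t)) (r + 1 - t) := fun h => by
    rw [hP]
    exact (encodesGraph_path (by omega) h).isCopyOfGraph pathGraph_triangle_free
  have hscarf : r ≤ 2 * t → IsScarf (connectedIdeal k (SimpleGraph.pathGraph r) t) := fun h => by
    have h' := hpath h
    rw [hP] at h' ⊢
    exact isScarf_of_path (encodesGraph_path (by omega) h) h' (hasPathQuotients_arc (by omega) h)
  have hdisc : r = t + 1 →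
      IsDiscrete (scarf (connectedIdeal k (SimpleGraph.cycleGraph r) t)) (t + 1) := by
    rintro rfl
    rw [hC (by omega)]
    exact (encodesGraph_bot (by omega)).isCopyOfGraph fun _ _ _ h => h.elim
  refine ⟨⟨fun h => ?_, hscarf⟩, ⟨fun h => ?_, fun h => ?_⟩, hpath, fun h => ?_, hdisc,
    fun h1 h2 => ?_⟩
  · by_contra hlt
    rw [hP] at h
    exact not_isScarf_of_first_arcs k (by omega) (by omega) (by omega) (by omega)
      (Or.inl (by omega)) h
  · by_contra hlt
    have hC := hC (by omega)
    rcases (by omega : r = t + 1 ∨ (t + 2 ≤ r ∧ r ≤ 2 * t + 1) ∨ 2 * t + 2 ≤ r) with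
      h1 | ⟨h1, h2⟩ | h1
    · subst h1
      have hd := hdisc rfl
      have hE := encodesGraph_bot (t := t) (by omega)
      rw [hC] at h hd
      refine not_isScarf_of_card_le_one hE.antichain hE.nonempty (i := 0) (j := Fin.last t)
        (by simp [Fin.ext_iff]; omega) (fun σ hσ => ?_) h
      obtain ⟨f, hf⟩ := hd
      rcases (hf σ).1 hσ with h0 | ⟨w, hw⟩ | ⟨_, _, h0, _⟩
      · simp [Finset.coe_eq_empty.1 h0]
      · simp [Finset.coe_eq_singleton.1 hw]
      · exact h0.elim
    · rw [hC] at h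
      have hE := encodesGraph_cycle (by omega) h1 h2
      obtain ⟨N, rfl⟩ := Nat.exists_eq_add_of_le' hr
      exact not_isScarf_of_polygon hE.antichain (Function.Embedding.refl _) hE
        (cycleGraph_triangle_free (by omega)) Finset.univ (by simp) h
    · rw [hC] at h
      exact not_isScarf_of_first_arcs k (by omega) (by omega) (by omega) le_rfl
        (Or.inr h1) h
  · rw [connectedIdeal_cycleGraph_of_le k (by omega) h]
    exact hscarf (by omega)
  · have hpoly : IsHollowPolygon (scarf (connectedIdeal k (SimpleGraph.pathGraph r) t))
        (t + 2) := by
      obtain rfl : r = 2 * t + 1 := h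
      have hn : 2 * t + 1 + 1 - t = t + 2 := by omega
      rw [hn] at hP
      rw [hP]
      exact ⟨by omega, (encodesGraph_cycle_of_le (by omega) le_rfl).isCopyOfGraph
        (cycleGraph_triangle_free (by omega))⟩
    exact ⟨hpoly, hpoly.nontrivial_homology k⟩
  · have hpoly : IsHollowPolygon (scarf (connectedIdeal k (SimpleGraph.cycleGraph r) t)) r := by
      rw [hC (by omega)]
      exact ⟨hr, (encodesGraph_cycle (by omega) h1 h2).isCopyOfGraph
        (cycleGraph_triangle_free (by omega))⟩
    exact ⟨hpoly, hpoly.nontrivial_homology k⟩
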